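/- Let $\mathcal S$ be the set of probability distributions $\mathbf q=(q_n)_{n\ge 0}$ on $\mathbb N=\{0,1,2,\dots\}$. For $\mathbf q\in\mathcal S$ with $\sum_n n q_n<\infty$ put $a(\mathbf q)=\sum_{k\ge 2}k q_k$ and $$\mathcal F[\mathbf q]_0=-a(\mathbf q)q_0,\qquad \mathcal F[\mathbf q]_1=2q_2-a(\mathbf q)(q_1-q_0),$$ $$\mathcal F[\mathbf q]_n=(n+1)q_{n+1}-nq_n-a(\mathbf q)(q_n-q_{n-1})\quad(n\ge 2).$$ A (classical) solution of the mean-field dispersion system $\mathbf p'(t)=\mathcal F[\mathbf p(t)]$ is a map $\mathbf p:[0,\infty)\to\mathcal S$ which is continuous for the weighted norm $\sum_n(1+n)|q_n|$ (in particular finite along $\mathbf p$), is $C^1$ on $[0,\infty)$ with values in $\ell^\infty$, and satisfies the equation for all $t\ge0$. Write $\langle t\rangle=\sqrt{1+t^2}$, and let $W_0$ be the principal branch of the Lambert function, i.e. for $x\ge -e^{-1}$, $W_0(x)$ is the unique $y\ge -1$ with $ye^{y}=x$. **Theorem.** Let $\mathbf p^0\in\mathcal S$ have finite mean $\mu=\sum_n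 n p^0_n$, and if $\mu\le 1$ assume in addition that its second moment $\sum_n n^2p^0_n$ is finite. Then there is a constant $C>0$, depending only on the second moment of $\mathbf p^0$ when $\mu\le 1$ and only on $\mu$ when $\mu>1$, such that the solution $\mathbf p$ with $\mathbf p(0)=\mathbf p^0$ satisfies the following. 1. If $0<\mu<1$, then $\|\mathbf p(t)-\mathbf p^*\|_{\ell^1}\le C e^{-2(1-\mu)t}$ for all $t\ge 0$. 2. If $\mu=1$, then $\|\mathbf p(t)-\mathbf p^*\|_{\ell^1}\le C\,t^{-1}$ for all $t>0$. For $\mu>1$ let $\nu=\mu+W_0(-\mu e^{-\mu})$. 3. If $1<\mu<\frac{e}{e-1}$, then $\|\mathbf p(t)-\bar{\mathbf p}\|_{\ell^1}\le C\langle t\rangle^{1/2}e^{-\nu t}$ for all $t\ge 0$. 4. If $\mu\ge\frac{e}{e-1}$, then there is $K>0$ depending only on $\mu$ such that $\|\mathbf p(t)-\bar{\mathbf p}\|_{\ell^1}\le C\langle t\rangle^{K+1/2}e^{-t}$ for all $t\ge 0$. Here $\mathbf p^*=(1-\mu,\mu,0,0,\dots)$ is the Bernoulli law, and $\bar{\mathbf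 p}$ is the zero-truncated Poisson law $\bar p_0=0$, $\bar p_n=\frac{\nu^n}{n!}\cdot\frac{1}{e^\nu-1}$ for $n\ge1$. -/

import Mathlib

open Filter Topology

namespace Dispersion

/-- The set `𝒮` of probability distributions on `ℕ`. -/
structure IsDistribution (q : ℕ → ℝ) : Prop where
  nonneg : ∀ n, 0 ≤ q n
  le_one : ∀ n, q n ≤ 1
  hasSum_one : HasSum q 1

/-- The number of active particles per site, `a = ∑_{k ≥ 2} k q_k`. -/
noncomputable def active (q : ℕ → ℝ) : ℝ :=
  ∑' k : ℕ, if 2 ≤ k then (k : ℝ) * q k else 0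

/-- The generator `ℱ` of the mean-field dispersion system, in components. -/
noncomputable def generator (q : ℕ → ℝ) : ℕ → ℝ
  | 0 => -(active q * q 0)
  | 1 => 2 * q 2 - active q * (q 1 - q 0)
  | (n + 2) =>
      ((n : ℝ) + 3) * q (n + 3) - ((n : ℝ) + 2) * q (n + 2)
        - active q * (q (n + 2) - q (n + 1))

/-- Classical solutions `p ∈ C([0,∞); 𝒮) ∩ C¹([0,∞); ℓ^∞)` of `p' = ℱ[p]`, where `𝒮` carries the
weighted norm `∑ (1 + n) |q_n|`. The values of `p` at negative times are irrelevant. -/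
structure IsClassicalSolution (p : ℝ → ℕ → ℝ) : Prop where
  /-- `p(t)` is a probability distribution. -/
  isDistribution : ∀ t, 0 ≤ t → IsDistribution (p t)
  /-- `p` is finite and continuous in the weighted norm: `q ↦ ((1 + n) q_n)_n` is an isometry from
  the weighted space to `ℓ¹`. -/
  continuous_weighted : ∃ w : ℝ → lp (fun _ : ℕ => ℝ) 1,
    (∀ t, 0 ≤ t → ∀ n : ℕ, w t n = (1 + (n : ℝ)) * p t n) ∧ ContinuousOn w (Set.Ici 0)
  /-- `p` is continuously differentiable with values in `ℓ^∞` (one-sided at time `0`). -/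
  contDiff_sup : ∃ u : ℝ → lp (fun _ : ℕ => ℝ) ⊤,
    (∀ t, 0 ≤ t → ∀ n : ℕ, u t n = p t n) ∧ ContDiffOn ℝ 1 u (Set.Ici 0)
  /-- The equation `p'(t) = ℱ[p(t)]` holds for all `t ≥ 0`. -/
  equation : ∀ t, 0 ≤ t → ∀ n : ℕ,
    HasDerivWithinAt (fun s => p s n) (generator (p t) n) (Set.Ici 0) t

/-- The `ℓ¹` distance of two sequences (only used for summable sequences). -/
noncomputable def ell1Dist (q r : ℕ → ℝ) : ℝ := ∑' n : ℕ, |q n - r n|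

/-- The Japanese bracket `⟨t⟩ = √(1 + t²)`. -/
noncomputable def japaneseBracket (t : ℝ) : ℝ := Real.sqrt (1 + t ^ 2)

/-- The principal branch `W₀` of the Lambert function: the inverse of `y ↦ y e^y` on `[-1, ∞)`.
Its value at `x < -e⁻¹` is irrelevant. -/
noncomputable def lambertW0 : ℝ → ℝ :=
  Function.invFunOn (fun y : ℝ => y * Real.exp y) (Set.Ici (-1))

/-- The parameter `ν = μ + W₀(-μ e^{-μ})`. -/
noncomputable def nu (μ : ℝ) : ℝ := μ + lambertW0 (-μ * Real.exp (-μ))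

/-- The Bernoulli law `(1 - μ, μ, 0, 0, …)`. -/
noncomputable def bernoulliLaw (μ : ℝ) : ℕ → ℝ
  | 0 => 1 - μ
  | 1 => μ
  | _ + 2 => 0

/-- The zero-truncated Poisson law with parameter `ν`. -/
noncomputable def truncatedPoisson (ν : ℝ) : ℕ → ℝ
  | 0 => 0
  | n + 1 => ν ^ (n + 1) / ((n + 1).factorial : ℝ) * (1 / (Real.exp ν - 1))

/-- `p` is a classical solution whose initial value `p0` is a probability distribution on `ℕ` with
(finite) mean `μ`. -/
structure IsSolutionFrom (p0 : ℕ → ℝ) (μ : ℝ) (p : ℝ → ℕ → ℝ) : Prop where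
  initial_distribution : IsDistribution p0
  initial_mean : HasSum (fun n : ℕ => (n : ℝ) * p0 n) μ
  solution : IsClassicalSolution p
  initial_value : p 0 = p0

end Dispersion

namespace Dispersion

open Set MeasureTheory

/-! Describe the law by its tails `h k = P(X > k)`, whose sum is the conserved mean `μ`. They solve
a system that is linear once the activity `a = μ - h 0 + h 1` is given, and the empty fraction `1 -
h 0` decays at rate exactly `a`.

For `μ ≤ 1` the distance to the Bernoulli law is `2 * a` (`ell1Dist_bernoulliLaw`). Half the second
factorial moment, `S = ∑ k * h k`, satisfies `S' = -2 S + μ a` with `a ≤ 2 S`, hence decays at rate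
`2 (1 - μ)` (`active_le_exp`). If `μ = 1`, then `a` lies between `y = 1 - h 0` and `2 y`, so that
`y' ≤ -y ^ 2` (`empty_le_inv`).

For `μ > 1`, duality with an explicit solution of the adjoint system gives a scalar Volterra
equation for `h 1 - (μ - 1) * h 0`, with an error `O(exp (-T))` that uses only the mean of the
initial law (`abs_sub_integral_gain_le`). Its nonlinearity is monotone on the relevant range, so a
lower bound `m < ν` for the activity improves itself (`limit_active_gt`); thus the activity
eventually exceeds every `m < ν`, uniformly in the solution (`eventually_le_active`). For `m` close
to `ν` the equation is then a contraction in exponentially weighted norms, and `|a - ν|` is `O(exp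
(-min ν 1 * t))` (`exists_abs_active_sub_nu_le`). Finally, the `ℓ¹` distance to the stationary tails
is damped at rate `1` with source `2 |a - ν|` (`tsum_abs_sub_le`): this yields `exp (-ν t)` if `ν <
1` and `(1 + t) exp (-t)` if `ν ≥ 1`. -/

/-! ### Comparison principles and truncation of series. -/

theorem sub_le_sub_of_deriv_right_le {f f' g g' : ℝ → ℝ} {T : ℝ} (hT : 0 ≤ T)
    (hf : ContinuousOn f (Icc 0 T))
    (hf' : ∀ s ∈ Ico 0 T, HasDerivWithinAt f (f' s) (Ici s) s)
    (hg : ContinuousOn g (Icc 0 T))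
    (hg' : ∀ s ∈ Ico 0 T, HasDerivWithinAt g (g' s) (Ici s) s)
    (hle : ∀ s ∈ Ico 0 T, f' s ≤ g' s) : f T - f 0 ≤ g T - g 0 := by
  have := image_le_of_deriv_right_le_deriv_boundary hf hf'
    (B := fun s => f 0 + (g s - g 0)) (B' := g') (by simp)
    (continuousOn_const.add (hg.sub continuousOn_const))
    (fun s hs => ((hg' s hs).sub_const _).const_add _) hle (right_mem_Icc.2 hT)
  linarith

/-- Series are handled through partial sums `F N`: the flux `E N` across the cut-off is bounded and
tends to `0` pointwise, so its time integral vanishes in the limit by dominated convergence. -/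
theorem sub_le_sub_of_tendsto_deriv_right_le {F F' E : ℕ → ℝ → ℝ} {g g' : ℝ → ℝ}
    {T B A₀ A : ℝ} (hT : 0 ≤ T)
    (hF : ∀ N, ContinuousOn (F N) (Icc 0 T))
    (hF' : ∀ N, ∀ s ∈ Ico 0 T, HasDerivWithinAt (F N) (F' N s) (Ici s) s)
    (hg : ContinuousOn g (Icc 0 T))
    (hg' : ∀ s ∈ Ico 0 T, HasDerivWithinAt g (g' s) (Ici s) s)
    (hE : ∀ N, ContinuousOn (E N) (Icc 0 T))
    (hEB : ∀ N, ∀ s ∈ Icc 0 T, |E N s| ≤ B)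
    (hE0 : ∀ s ∈ Icc 0 T, Tendsto (fun N => E N s) atTop (𝓝 0))
    (hle : ∀ N, ∀ s ∈ Ico 0 T, F' N s ≤ E N s + g' s)
    (h0 : Tendsto (fun N => F N 0) atTop (𝓝 A₀))
    (h1 : Tendsto (fun N => F N T) atTop (𝓝 A)) : A - A₀ ≤ g T - g 0 := by
  set J : ℕ → ℝ → ℝ := fun N => IccExtend hT ((Icc 0 T).domRestrict (E N)) with hJ
  have hJc : ∀ N, Continuous (J N) := fun N => (hE N).domRestrict.Icc_extend'
  have hJE : ∀ N, ∀ s ∈ Icc 0 T, J N s = E N s := fun N s hs => by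
    simp [hJ, IccExtend_of_mem hT _ hs]
  have hJd : ∀ N s, HasDerivAt (fun t => ∫ r in (0 : ℝ)..t, J N r) (J N s) s := fun N s =>
    intervalIntegral.integral_hasDerivAt_right ((hJc N).intervalIntegrable _ _)
      (hJc N).stronglyMeasurable.stronglyMeasurableAtFilter (hJc N).continuousAt
  have hlim : Tendsto (fun N => ∫ r in (0 : ℝ)..T, J N r) atTop (𝓝 0) := by
    have := intervalIntegral.tendsto_integral_filter_of_dominated_convergence
      (μ := volume) (a := 0) (b := T) (l := atTop) (F := J) (f := fun _ => (0 : ℝ)) (fun _ => B)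
      (Eventually.of_forall fun N => (hJc N).aestronglyMeasurable)
      (Eventually.of_forall fun N => Eventually.of_forall fun s hs => by
        rw [uIoc_of_le hT] at hs
        rw [hJE N s ⟨hs.1.le, hs.2⟩]
        exact hEB N s ⟨hs.1.le, hs.2⟩)
      (by simp)
      (Eventually.of_forall fun s hs => by
        rw [uIoc_of_le hT] at hs
        have hs' : s ∈ Icc 0 T := ⟨hs.1.le, hs.2⟩
        exact (hE0 s hs').congr fun N => (hJE N s hs').symm)
    simpa using this
  have key : ∀ N, F N T - F N 0 ≤ (∫ r in (0 : ℝ)..T, J N r) + (g T - g 0) := fun N => by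
    have := sub_le_sub_of_deriv_right_le hT (hF N) (hF' N)
      (g := fun s => (∫ r in (0 : ℝ)..s, J N r) + g s) (g' := fun s => J N s + g' s)
      ((continuous_iff_continuousAt.2 fun s => (hJd N s).continuousAt).continuousOn.add hg)
      (fun s hs => (hJd N s).hasDerivWithinAt.add (hg' s hs))
      (fun s hs => by rw [hJE N s ⟨hs.1, hs.2.le⟩]; exact hle N s hs)
    simp only [intervalIntegral.integral_same] at this
    linarith
  have := le_of_tendsto_of_tendsto' (h1.sub h0) (hlim.add_const (g T - g 0)) key
  simpa using this

/-- The right derivative of `|e|` when `e' = -c e + F`. -/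
theorem exists_deriv_right_abs_le {e : ℝ → ℝ} {c F s : ℝ}
    (he : HasDerivWithinAt e (-c * e s + F) (Ici s) s) :
    ∃ d, HasDerivWithinAt (fun t => |e t|) d (Ici s) s ∧ d ≤ -c * |e s| + |F| := by
  rcases lt_trichotomy (e s) 0 with h | h | h
  · refine ⟨_, (hasDerivAt_abs_neg h).comp_hasDerivWithinAt s he, ?_⟩
    rw [abs_of_neg h]
    linarith [neg_abs_le F]
  -- At a zero of `e` the right slopes of `|e|` are the absolute values of those of `e`; a two-sided
  -- derivative need not exist.
  · refine ⟨|F|, ?_, by simp [h]⟩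
    rw [h, mul_zero, zero_add, hasDerivWithinAt_iff_tendsto_slope] at he
    rw [hasDerivWithinAt_iff_tendsto_slope]
    refine he.abs.congr' ?_
    filter_upwards [self_mem_nhdsWithin] with x hx
    have hx' : 0 ≤ x - s := sub_nonneg.2 hx.1
    simp [slope_def_field, h, abs_div, abs_of_nonneg hx']
  · refine ⟨_, (hasDerivAt_abs_pos h).comp_hasDerivWithinAt s he, ?_⟩
    rw [abs_of_pos h]
    linarith [le_abs_self F]

/-- For `k < N` the term `w k * h N` is dominated by `w k * h k`. The weights `1` and `k` make the
cut-off fluxes of the first and second moments vanish. -/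
theorem tendsto_sum_mul_of_antitone {w h : ℕ → ℝ} (hw : ∀ k, 0 ≤ w k) (h0 : ∀ k, 0 ≤ h k)
    (hanti : Antitone h) (hsum : Summable fun k => w k * h k) (hlim : Tendsto h atTop (𝓝 0)) :
    Tendsto (fun N => (∑ k ∈ Finset.range N, w k) * h N) atTop (𝓝 0) := by
  have key := tendsto_tsum_of_dominated_convergence (𝓕 := atTop)
    (f := fun N k => if k ∈ Finset.range N then w k * h N else 0) (g := fun _ => (0 : ℝ))
    hsum (fun k => ?_) (Eventually.of_forall fun N k => ?_)
  · rw [tsum_zero] at key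
    refine key.congr fun N => ?_
    rw [tsum_eq_sum (s := Finset.range N) (fun k hk => by rw [if_neg hk]), Finset.sum_mul]
    exact Finset.sum_congr rfl fun k hk => by rw [if_pos hk]
  · have : Tendsto (fun N => w k * h N) atTop (𝓝 0) := by simpa using hlim.const_mul (w k)
    refine this.congr' ?_
    filter_upwards [eventually_gt_atTop k] with N hN
    simp [hN]
  · split_ifs with hk
    · rw [Real.norm_eq_abs, abs_of_nonneg (mul_nonneg (hw k) (h0 N))]
      exact mul_le_mul_of_nonneg_left (hanti (Finset.mem_range.1 hk).le) (hw k)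
    · simpa using mul_nonneg (hw k) (h0 k)

/-! ### Tails and moments. -/

/-- The tail `P(X > k)` of a law `q` on `ℕ`. -/
noncomputable def tail (q : ℕ → ℝ) (k : ℕ) : ℝ := 1 - ∑ n ∈ Finset.range (k + 1), q n

theorem tail_zero (q : ℕ → ℝ) : tail q 0 = 1 - q 0 := by simp [tail]

theorem tail_succ (q : ℕ → ℝ) (k : ℕ) : tail q (k + 1) = tail q k - q (k + 1) := by
  rw [tail, tail, Finset.sum_range_succ _ (k + 1)]; ring

theorem sum_tail (q : ℕ → ℝ) (N : ℕ) :
    ∑ k ∈ Finset.range N, tail q k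
      = (∑ n ∈ Finset.range (N + 1), (n : ℝ) * q n) + N * tail q N := by
  induction N with
  | zero => simp
  | succ N ih =>
    rw [Finset.sum_range_succ, ih, Finset.sum_range_succ _ (N + 1), tail_succ]
    push_cast; ring

theorem two_mul_sum_mul_tail (q : ℕ → ℝ) (N : ℕ) :
    2 * ∑ k ∈ Finset.range N, (k : ℝ) * tail q k
      = (∑ n ∈ Finset.range (N + 1), ((n : ℝ) ^ 2 - n) * q n) + ((N : ℝ) ^ 2 - N) * tail q N := by
  induction N with
  | zero => simp
  | succ N ih =>
    rw [Finset.sum_range_succ, mul_add, ih, Finset.sum_range_succ _ (N + 1), tail_succ]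
    push_cast; ring

namespace IsDistribution

variable {q : ℕ → ℝ} (hq : IsDistribution q)
include hq

theorem tail_nonneg (k : ℕ) : 0 ≤ tail q k :=
  sub_nonneg.2 (sum_le_hasSum _ (fun n _ => hq.nonneg n) hq.hasSum_one)

theorem tail_antitone : Antitone (tail q) :=
  antitone_nat_of_succ_le fun k => by
    rw [tail_succ]; linarith [hq.nonneg (k + 1)]

theorem tail_le_one : tail q 0 ≤ 1 := by
  rw [tail_zero]; linarith [hq.nonneg 0]

theorem hasSum_tail_shift (N : ℕ) : HasSum (fun n => q (n + (N + 1))) (tail q N) :=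
  (hasSum_nat_add_iff' (N + 1)).2 hq.hasSum_one

/-- Markov's inequality on `n > N`. Keeping the partial sum on the right makes `N * tail q N` tend
to `0`. -/
theorem mul_tail_le {f : ℕ → ℝ} (hf : Monotone f) {m : ℝ}
    (hm : HasSum (fun n => f n * q n) m) (N : ℕ) :
    f N * tail q N ≤ m - ∑ n ∈ Finset.range (N + 1), f n * q n :=
  hasSum_le (fun n => mul_le_mul_of_nonneg_right (hf (by omega)) (hq.nonneg _))
    ((hq.hasSum_tail_shift N).mul_left (f N)) ((hasSum_nat_add_iff' (N + 1)).2 hm)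

theorem hasSum_tail {m : ℝ} (hm : HasSum (fun n : ℕ => (n : ℝ) * q n) m) :
    HasSum (tail q) m := by
  rw [hasSum_iff_tendsto_nat_of_nonneg hq.tail_nonneg]
  have h1 : Tendsto (fun N => ∑ n ∈ Finset.range (N + 1), (n : ℝ) * q n) atTop (𝓝 m) :=
    hm.tendsto_sum_nat.comp (tendsto_add_atTop_nat 1)
  have h2 : Tendsto (fun N : ℕ => (N : ℝ) * tail q N) atTop (𝓝 0) := by
    refine squeeze_zero (fun N => mul_nonneg N.cast_nonneg (hq.tail_nonneg N))
      (fun N => hq.mul_tail_le Nat.mono_cast hm N) ?_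
    simpa using h1.const_sub m
  simpa [sum_tail] using h1.add h2

theorem two_mul_sum_mul_tail_le {m : ℝ} (hm : HasSum (fun n : ℕ => (n : ℝ) ^ 2 * q n) m)
    (N : ℕ) : 2 * ∑ k ∈ Finset.range N, (k : ℝ) * tail q k ≤ m := by
  have h1 := hq.mul_tail_le (f := fun n => (n : ℝ) ^ 2)
    (fun a b hab => by dsimp only; gcongr) hm N
  have h2 : ∑ n ∈ Finset.range (N + 1), ((n : ℝ) ^ 2 - n) * q n
      ≤ ∑ n ∈ Finset.range (N + 1), (n : ℝ) ^ 2 * q n :=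
    Finset.sum_le_sum fun n _ =>
      mul_le_mul_of_nonneg_right (by linarith [n.cast_nonneg (α := ℝ)]) (hq.nonneg n)
  have h3 := mul_nonneg N.cast_nonneg (hq.tail_nonneg N)
  rw [two_mul_sum_mul_tail]
  linarith

end IsDistribution

/-! ### Tail equations and conservation of the mean. -/

theorem active_eq_of_hasSum {q : ℕ → ℝ} {m : ℝ} (hm : HasSum (fun n : ℕ => (n : ℝ) * q n) m) :
    active q = m - q 1 := by
  have h1 : HasSum (fun n : ℕ => if n = 1 then q 1 else 0) (q 1) := hasSum_ite_eq 1 (q 1)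
  refine ((hm.sub h1).congr_fun fun n => ?_).tsum_eq
  rcases n with _ | _ | n <;> simp

/-- The generator is in divergence form; what survives is the net flux between `k + 1` and `k + 2`.
-/
theorem sum_generator (q : ℕ → ℝ) (k : ℕ) :
    ∑ n ∈ Finset.range (k + 2), generator q n
      = ((k : ℝ) + 2) * q (k + 2) - active q * q (k + 1) := by
  induction k with
  | zero => simp [Finset.sum_range_succ, generator]; ring
  | succ k ih =>
    rw [Finset.sum_range_succ, ih]
    simp only [generator]
    push_cast; ring

/-- A solution in terms of its tails `h k t` and the number `a t` of active particles per site. -/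
structure TailFlow (μ : ℝ) (a : ℝ → ℝ) (h : ℕ → ℝ → ℝ) : Prop where
  continuous : Continuous a
  deriv_zero : ∀ t, 0 ≤ t →
    HasDerivWithinAt (h 0) (μ - (1 + a t) * h 0 t + h 1 t) (Ici 0) t
  deriv_succ : ∀ (k : ℕ) (t), 0 ≤ t →
    HasDerivWithinAt (h (k + 1))
      (((k : ℝ) + 2) * h (k + 2) t - ((k : ℝ) + 2 + a t) * h (k + 1) t + a t * h k t) (Ici 0) t
  antitone : ∀ t, 0 ≤ t → Antitone fun k => h k t
  nonneg : ∀ (k : ℕ) (t), 0 ≤ t → 0 ≤ h k t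
  le_one : ∀ t, 0 ≤ t → h 0 t ≤ 1
  hasSum : ∀ t, 0 ≤ t → HasSum (fun k => h k t) μ
  active_eq : ∀ t, 0 ≤ t → a t = μ - h 0 t + h 1 t

namespace IsClassicalSolution

variable {p : ℝ → ℕ → ℝ} (hp : IsClassicalSolution p)
include hp

theorem exists_mean : ∃ m : ℝ → ℝ, ContinuousOn m (Ici 0) ∧
    ∀ t, 0 ≤ t → HasSum (fun n : ℕ => (n : ℝ) * p t n) (m t) := by
  obtain ⟨w, hw, hwc⟩ := hp.continuous_weighted
  -- For a probability law the weighted norm is `1` plus the mean.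
  refine ⟨fun t => ‖w t‖ - 1, hwc.norm.sub continuousOn_const, fun t ht => ?_⟩
  have h1 : HasSum (fun n => ‖w t n‖) ‖w t‖ := by
    have := lp.hasSum_norm (p := 1) (by simp) (w t)
    simpa using this
  refine (h1.sub (hp.isDistribution t ht).hasSum_one).congr_fun fun n => ?_
  rw [hw t ht, Real.norm_eq_abs, abs_of_nonneg]
  · ring
  · have := (hp.isDistribution t ht).nonneg n
    positivity

theorem tail_hasDerivWithinAt (k : ℕ) {t : ℝ} (ht : 0 ≤ t) :
    HasDerivWithinAt (fun s => tail (p s) k)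
      (-∑ n ∈ Finset.range (k + 1), generator (p t) n) (Ici 0) t :=
  (HasDerivWithinAt.fun_sum fun n _ => hp.equation t ht n).const_sub 1

/-- Partial sums of tails change only by the flux `E N`: the first moment beyond the cut-off minus
the activity times a tail. It is dominated by the mean, which is bounded on `[0, T]` by continuity,
so the comparison applies in both directions. -/
theorem mean_eq {m : ℝ → ℝ} (hmc : ContinuousOn m (Ici 0))
    (hm : ∀ t, 0 ≤ t → HasSum (fun n : ℕ => (n : ℝ) * p t n) (m t)) {T : ℝ} (hT : 0 ≤ T) :
    m T = m 0 := by
  have hd := hp.isDistribution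
  set E : ℕ → ℝ → ℝ := fun N t =>
    (m t - ∑ n ∈ Finset.range (N + 2), (n : ℝ) * p t n)
      - (m t - p t 1) * tail (p t) N with hE
  have hpc : ∀ n, ContinuousOn (fun t => p t n) (Icc 0 T) := fun n t ht =>
    ((hp.equation t ht.1 n).continuousWithinAt).mono Icc_subset_Ici_self
  have hhc : ∀ n, ContinuousOn (fun t => tail (p t) n) (Icc 0 T) := fun n t ht =>
    ((hp.tail_hasDerivWithinAt n ht.1).continuousWithinAt).mono Icc_subset_Ici_self
  have hmc' : ContinuousOn m (Icc 0 T) := hmc.mono Icc_subset_Ici_self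
  have hEc : ∀ N, ContinuousOn (E N) (Icc 0 T) := fun N =>
    (hmc'.sub (continuousOn_finsetSum _ fun n _ => continuousOn_const.mul (hpc n))).sub
      ((hmc'.sub (hpc 1)).mul (hhc N))
  obtain ⟨B, hB⟩ := (isCompact_Icc (a := (0 : ℝ)) (b := T)).exists_bound_of_continuousOn hmc'
  have hEB : ∀ N, ∀ s ∈ Icc 0 T, |E N s| ≤ B := fun N s hs => by
    have hmB : m s ≤ B := (le_abs_self _).trans (hB s hs)
    have hs0 := hs.1
    have hn : ∀ n : ℕ, 0 ≤ (n : ℝ) * p s n := fun n => mul_nonneg n.cast_nonneg ((hd s hs0).nonneg n)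
    have h1 : ∑ n ∈ Finset.range (N + 2), (n : ℝ) * p s n ≤ m s :=
      sum_le_hasSum _ (fun n _ => hn n) (hm s hs0)
    have h2 : (0 : ℝ) ≤ ∑ n ∈ Finset.range (N + 2), (n : ℝ) * p s n :=
      Finset.sum_nonneg fun n _ => hn n
    have h3 : p s 1 ≤ m s := by
      simpa using le_hasSum (hm s hs0) 1 (fun n _ => hn n)
    have h4 := (hd s hs0).nonneg 1
    have h5 := (hd s hs0).tail_nonneg N
    have h6 : tail (p s) N ≤ 1 := ((hd s hs0).tail_antitone N.zero_le).trans (hd s hs0).tail_le_one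
    have h7 : (m s - p s 1) * tail (p s) N ≤ m s - p s 1 :=
      mul_le_of_le_one_right (by linarith) h6
    have h8 : 0 ≤ (m s - p s 1) * tail (p s) N := mul_nonneg (by linarith) h5
    rw [abs_le]; constructor <;> simp only [hE] <;> linarith
  have hE0 : ∀ s ∈ Icc 0 T, Tendsto (fun N => E N s) atTop (𝓝 0) := fun s hs => by
    have h1 : Tendsto (fun N => ∑ n ∈ Finset.range (N + 2), (n : ℝ) * p s n) atTop (𝓝 (m s)) :=
      (hm s hs.1).tendsto_sum_nat.comp (tendsto_add_atTop_nat 2)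
    have h2 := ((hd s hs.1).hasSum_tail (hm s hs.1)).summable.tendsto_atTop_zero
    simpa [hE] using (h1.const_sub (m s)).sub (h2.const_mul (m s - p s 1))
  have hsum : ∀ (N : ℕ) (t : ℝ), 0 ≤ t →
      ∑ k ∈ Finset.range (N + 1), (-∑ n ∈ Finset.range (k + 1), generator (p t) n) = E N t := by
    intro N t ht
    have ha := active_eq_of_hasSum (hm t ht)
    induction N with
    | zero =>
      simp [hE, generator, ha, Finset.sum_range_succ, tail_zero]; ring
    | succ N ih =>
      rw [Finset.sum_range_succ, ih, sum_generator, ha]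
      simp only [hE]
      rw [Finset.sum_range_succ _ (N + 2), tail_succ]
      push_cast; ring
  have hF' : ∀ (N : ℕ) (s : ℝ), 0 ≤ s →
      HasDerivWithinAt (fun t => ∑ k ∈ Finset.range (N + 1), tail (p t) k) (E N s) (Ici 0) s :=
    fun N s hs => by
      rw [← hsum N s hs]
      exact HasDerivWithinAt.fun_sum fun k _ => hp.tail_hasDerivWithinAt k hs
  have hlim : ∀ s, 0 ≤ s →
      Tendsto (fun N => ∑ k ∈ Finset.range (N + 1), tail (p s) k) atTop (𝓝 (m s)) := fun s hs =>
    (((hd s hs).hasSum_tail (hm s hs)).tendsto_sum_nat).comp (tendsto_add_atTop_nat 1)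
  have hFc : ∀ N : ℕ,
      ContinuousOn (fun t => ∑ k ∈ Finset.range (N + 1), tail (p t) k) (Icc 0 T) := fun N =>
    continuousOn_finsetSum _ fun k _ => hhc k
  refine le_antisymm ?_ ?_
  · have := sub_le_sub_of_tendsto_deriv_right_le hT hFc
      (fun N s hs => (hF' N s hs.1).mono (Ici_subset_Ici.2 hs.1)) (g := fun _ => 0)
      (g' := fun _ => 0) continuousOn_const (fun s _ => hasDerivWithinAt_const _ _ _)
      hEc hEB hE0 (fun N s _ => by simp) (hlim 0 le_rfl) (hlim T hT)
    linarith
  · have := sub_le_sub_of_tendsto_deriv_right_le hT (fun N => (hFc N).neg)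
      (fun N s hs => ((hF' N s hs.1).mono (Ici_subset_Ici.2 hs.1)).neg) (g := fun _ => 0)
      (g' := fun _ => 0) continuousOn_const (fun s _ => hasDerivWithinAt_const _ _ _)
      (fun N => (hEc N).neg) (B := B) (fun N s hs => by simpa using hEB N s hs)
      (fun s hs => by simpa using (hE0 s hs).neg) (fun N s _ => by simp)
      (hlim 0 le_rfl).neg (hlim T hT).neg
    linarith

end IsClassicalSolution

/-- The number of active particles along `p`, extended constantly to negative times. -/
noncomputable def activeAlong (μ : ℝ) (p : ℝ → ℕ → ℝ) (t : ℝ) : ℝ := μ - p (max t 0) 1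

theorem IsSolutionFrom.tailFlow {μ : ℝ} {p0 : ℕ → ℝ} {p : ℝ → ℕ → ℝ}
    (hp : IsSolutionFrom p0 μ p) :
    TailFlow μ (activeAlong μ p) (fun k t => tail (p t) k) := by
  have hs := hp.solution
  have hd := hs.isDistribution
  obtain ⟨m, hmc, hm⟩ := hs.exists_mean
  have hmean : ∀ t, 0 ≤ t → HasSum (fun n : ℕ => (n : ℝ) * p t n) μ := fun t ht => by
    have h0 := hm 0 le_rfl
    rw [hp.initial_value] at h0
    rw [hp.initial_mean.unique h0, ← hs.mean_eq hmc hm ht]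
    exact hm t ht
  have hact : ∀ t, 0 ≤ t → activeAlong μ p t = active (p t) := fun t ht => by
    rw [activeAlong, max_eq_left ht, active_eq_of_hasSum (hmean t ht)]
  have hact' : ∀ t, 0 ≤ t → activeAlong μ p t = μ - tail (p t) 0 + tail (p t) 1 := fun t ht => by
    rw [activeAlong, max_eq_left ht, tail_succ, tail_zero]; ring
  refine ⟨?_, fun t ht => ?_, fun k t ht => ?_, fun t ht => (hd t ht).tail_antitone,
    fun k t ht => (hd t ht).tail_nonneg k, fun t ht => (hd t ht).tail_le_one,
    fun t ht => (hd t ht).hasSum_tail (hmean t ht), hact'⟩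
  · have h1 : ContinuousOn (fun t => p t 1) (Ici 0) := fun t ht =>
      (hs.equation t ht 1).continuousWithinAt
    have h2 : Continuous fun t : ℝ => max t 0 := by fun_prop
    exact continuous_const.sub (h1.comp_continuous h2 fun t => mem_Ici.2 (le_max_right _ _))
  · convert hs.tail_hasDerivWithinAt 0 ht using 1
    have := hact' t ht
    rw [hact t ht] at this ⊢
    rw [tail_zero] at this ⊢
    simp only [zero_add, Finset.sum_range_one, generator]
    linear_combination -this
  · convert hs.tail_hasDerivWithinAt (k + 1) ht using 1
    rw [sum_generator, hact t ht, tail_succ _ (k + 1), tail_succ _ k]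
    ring

/-! ### A priori bounds; decay of the activity for `μ ≤ 1`. -/

namespace TailFlow

variable {μ : ℝ} {a : ℝ → ℝ} {h : ℕ → ℝ → ℝ} (hf : TailFlow μ a h)
include hf

theorem continuousOn (k : ℕ) : ContinuousOn (h k) (Ici 0) := by
  cases k with
  | zero => exact fun t ht => (hf.deriv_zero t ht).continuousWithinAt
  | succ k => exact fun t ht => (hf.deriv_succ k t ht).continuousWithinAt

theorem sum_le {t : ℝ} (ht : 0 ≤ t) (N : ℕ) : ∑ k ∈ Finset.range N, h k t ≤ μ :=
  sum_le_hasSum _ (fun k _ => hf.nonneg k t ht) (hf.hasSum t ht)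

theorem mean_nonneg : 0 ≤ μ := by simpa using hf.sum_le le_rfl 0

theorem mul_le {t : ℝ} (ht : 0 ≤ t) (N : ℕ) : N * h N t ≤ μ := by
  refine le_trans ?_ (hf.sum_le ht N)
  have := Finset.card_nsmul_le_sum (Finset.range N) (fun k => h k t) (h N t)
    fun k hk => hf.antitone t ht (Finset.mem_range.1 hk).le
  simpa using this

theorem tendsto_zero {t : ℝ} (ht : 0 ≤ t) : Tendsto (fun k => h k t) atTop (𝓝 0) :=
  (hf.hasSum t ht).summable.tendsto_atTop_zero

theorem tendsto_mul {t : ℝ} (ht : 0 ≤ t) : Tendsto (fun k : ℕ => (k : ℝ) * h k t) atTop (𝓝 0) := by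
  have := tendsto_sum_mul_of_antitone (w := fun _ => 1) (fun _ => zero_le_one)
    (fun k => hf.nonneg k t ht) (hf.antitone t ht) (by simpa using (hf.hasSum t ht).summable)
    (hf.tendsto_zero ht)
  simpa using this

theorem active_le {t : ℝ} (ht : 0 ≤ t) : a t ≤ μ := by
  have := hf.antitone t ht (zero_le_one (α := ℕ))
  rw [hf.active_eq t ht]; dsimp only at this; linarith

theorem active_nonneg {t : ℝ} (ht : 0 ≤ t) : 0 ≤ a t := by
  have h1 := hf.sum_le ht 1
  have h2 := hf.nonneg 1 t ht
  simp only [Finset.sum_range_one] at h1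
  rw [hf.active_eq t ht]; linarith

theorem le_active {t : ℝ} (ht : 0 ≤ t) : μ - 1 ≤ a t := by
  have h1 := hf.le_one t ht
  have h2 := hf.nonneg 1 t ht
  rw [hf.active_eq t ht]; linarith

theorem deriv_empty {t : ℝ} (ht : 0 ≤ t) :
    HasDerivWithinAt (fun s => 1 - h 0 s) (-(a t * (1 - h 0 t))) (Ici 0) t := by
  refine ((hf.deriv_zero t ht).const_sub 1).congr_deriv ?_
  linear_combination hf.active_eq t ht

theorem deriv_sum_mul (N : ℕ) {t : ℝ} (ht : 0 ≤ t) :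
    HasDerivWithinAt (fun s => ∑ k ∈ Finset.range (N + 1), (k : ℝ) * h k s)
      (((N : ℝ) + 1) * N * h (N + 1) t - 2 * ∑ k ∈ Finset.range (N + 1), (k : ℝ) * h k t
        + a t * (∑ k ∈ Finset.range N, h k t - N * h N t)) (Ici 0) t := by
  induction N with
  | zero => simpa using hasDerivWithinAt_const _ _ _
  | succ N ih =>
    have := ih.add ((hf.deriv_succ N t ht).const_mul ((N : ℝ) + 1))
    have h1 : (fun s => ∑ k ∈ Finset.range (N + 1 + 1), (k : ℝ) * h k s)
        = (fun s => ∑ k ∈ Finset.range (N + 1), (k : ℝ) * h k s)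
          + fun s => ((N : ℝ) + 1) * h (N + 1) s := by
      funext s
      rw [Finset.sum_range_succ]; simp
    rw [h1]
    refine this.congr_deriv ?_
    rw [Finset.sum_range_succ _ (N + 1), Finset.sum_range_succ (fun k => h k t) N]
    push_cast; ring

/-- Each `h k` with `k < N` is at least `h N`. This lets the damping in `deriv_sum_mul` absorb its
boundary term. -/
theorem two_mul_sum_mul_ge (N : ℕ) {t : ℝ} (ht : 0 ≤ t) :
    (N : ℝ) * ((N : ℝ) - 1) * h N t ≤ 2 * ∑ k ∈ Finset.range N, (k : ℝ) * h k t := by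
  induction N with
  | zero => simp
  | succ N ih =>
    have h1 := hf.antitone t ht N.le_succ
    have h2 := hf.nonneg N t ht
    have h4 : ((N : ℝ) + 1) * N * h (N + 1) t ≤ ((N : ℝ) + 1) * N * h N t :=
      mul_le_mul_of_nonneg_left h1 (by positivity)
    rw [Finset.sum_range_succ]
    push_cast
    linarith

/-- A crude bound: it propagates finiteness of the second moment, which justifies the limit in
`active_le_exp`. -/
theorem sum_mul_le {V : ℝ} (hV : ∀ N, ∑ k ∈ Finset.range N, (k : ℝ) * h k 0 ≤ V) {T : ℝ}
    (hT : 0 ≤ T) (N : ℕ) : ∑ k ∈ Finset.range N, (k : ℝ) * h k T ≤ V + μ ^ 2 * T := by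
  have hμ := hf.mean_nonneg
  rcases N with _ | N
  · have := hV 0
    simp only [Finset.range_zero, Finset.sum_empty] at this ⊢
    positivity
  have := sub_le_sub_of_deriv_right_le hT
    (f := fun s => ∑ k ∈ Finset.range (N + 1), (k : ℝ) * h k s) (g := fun s => μ ^ 2 * s)
    (g' := fun _ => μ ^ 2)
    (fun s hs => ((hf.deriv_sum_mul N hs.1).continuousWithinAt).mono Icc_subset_Ici_self)
    (fun s hs => (hf.deriv_sum_mul N hs.1).mono (Ici_subset_Ici.2 hs.1))
    (by fun_prop) (fun s _ => by simpa using ((hasDerivAt_id s).const_mul (μ ^ 2)).hasDerivWithinAt)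
    (fun s hs => by
      have h1 := hf.two_mul_sum_mul_ge (N + 1) hs.1
      have h2 : a s * (∑ k ∈ Finset.range N, h k s - N * h N s) ≤ μ * μ := by
        have h3 := hf.sum_le hs.1 N
        have h4 := mul_nonneg N.cast_nonneg (hf.nonneg N s hs.1)
        refine (mul_le_mul_of_nonneg_left (by linarith) (hf.active_nonneg hs.1)).trans
          (mul_le_mul_of_nonneg_right (hf.active_le hs.1) hμ)
      push_cast at h1
      have h5 : ((N : ℝ) + 1) * ((N : ℝ) + 1 - 1) = ((N : ℝ) + 1) * N := by ring
      rw [h5] at h1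
      nlinarith)
  have h0 := hV (N + 1)
  simp only [mul_zero, sub_zero] at this
  linarith

/-- Reflects `n ≤ n * (n - 1)` for `n ≥ 2`; the last bracket is the part of the mean lost at the
cut-off. -/
theorem active_le_two_mul_sum (N : ℕ) {t : ℝ} (ht : 0 ≤ t) :
    a t ≤ 2 * ∑ k ∈ Finset.range (N + 2), (k : ℝ) * h k t
      + (μ - ∑ k ∈ Finset.range (N + 2), h k t) := by
  have h1 : 0 ≤ ∑ k ∈ Finset.range N, (2 * ((k : ℝ) + 2) - 1) * h (k + 2) t :=
    Finset.sum_nonneg fun k _ => mul_nonneg (by linarith [k.cast_nonneg (α := ℝ)])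
      (hf.nonneg _ t ht)
  have h2 : 2 * ∑ k ∈ Finset.range (N + 2), (k : ℝ) * h k t - ∑ k ∈ Finset.range (N + 2), h k t
      = (∑ k ∈ Finset.range N, (2 * ((k : ℝ) + 2) - 1) * h (k + 2) t) + h 1 t - h 0 t := by
    rw [Finset.mul_sum, ← Finset.sum_sub_distrib, Finset.sum_range_succ', Finset.sum_range_succ']
    have : ∀ k : ℕ, (2 * (((k + 1 + 1 : ℕ) : ℝ) * h (k + 1 + 1) t) - h (k + 1 + 1) t)
        = (2 * ((k : ℝ) + 2) - 1) * h (k + 2) t := fun k => by push_cast; ring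
    simp only [this]
    push_cast; ring
  rw [hf.active_eq t ht]
  linarith

/-- Exponential decay of the activity through the second factorial moment. -/
theorem active_le_exp {V : ℝ} (hV : ∀ N, ∑ k ∈ Finset.range N, (k : ℝ) * h k 0 ≤ V) {T : ℝ}
    (hT : 0 ≤ T) : a T ≤ 2 * V * Real.exp (-2 * (1 - μ) * T) := by
  have hμ := hf.mean_nonneg
  have hw : ∀ (k : ℕ) (t : ℝ), 0 ≤ t → 0 ≤ (k : ℝ) * h k t := fun k t ht =>
    mul_nonneg k.cast_nonneg (hf.nonneg k t ht)
  have hsm : ∀ t, 0 ≤ t → Summable fun k : ℕ => (k : ℝ) * h k t := fun t ht =>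
    summable_of_sum_range_le (fun k => hw k t ht) (hf.sum_mul_le hV ht)
  set c : ℝ := 2 * (1 - μ) with hc
  set S : ℕ → ℝ → ℝ := fun N t => ∑ k ∈ Finset.range (N + 2), (k : ℝ) * h k t with hS
  set R : ℕ → ℝ → ℝ := fun N t => μ - ∑ k ∈ Finset.range (N + 2), h k t with hR
  set D : ℕ → ℝ → ℝ := fun N t => ((N : ℝ) + 2) * (N + 1) * h (N + 2) t with hD
  have hRnn : ∀ N t, 0 ≤ t → 0 ≤ R N t := fun N t ht => sub_nonneg.2 (hf.sum_le ht _)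
  have hDnn : ∀ N t, 0 ≤ t → 0 ≤ D N t := fun N t ht => by
    have := hf.nonneg (N + 2) t ht
    simp only [hD]; positivity
  have hDS : ∀ N t, 0 ≤ t → D N t ≤ 2 * S N t := fun N t ht => by
    have := hf.two_mul_sum_mul_ge (N + 2) ht
    push_cast at this
    have h5 : ((N : ℝ) + 2) * ((N : ℝ) + 2 - 1) = ((N : ℝ) + 2) * (N + 1) := by ring
    rwa [h5] at this
  have hexp : ∀ t : ℝ, HasDerivAt (fun s => Real.exp (c * s)) (Real.exp (c * t) * c) t := fun t => by
    simpa using ((hasDerivAt_id t).const_mul c).exp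
  have hSd : ∀ N t, 0 ≤ t → HasDerivWithinAt (S N) (D N t - 2 * S N t
      + a t * (∑ k ∈ Finset.range (N + 1), h k t - (N + 1) * h (N + 1) t)) (Ici 0) t := by
    intro N t ht
    have := hf.deriv_sum_mul (N + 1) ht
    convert this using 1
    simp only [hD, hS]; push_cast; ring
  have hSc : ∀ N, ContinuousOn (S N) (Icc 0 T) := fun N s hs =>
    (hSd N s hs.1).continuousWithinAt.mono Icc_subset_Ici_self
  have hhc : ∀ k, ContinuousOn (h k) (Icc 0 T) := fun k => (hf.continuousOn k).mono
    Icc_subset_Ici_self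
  have hlimS : ∀ t, 0 ≤ t → Tendsto (fun N => S N t) atTop (𝓝 (∑' k : ℕ, (k : ℝ) * h k t)) :=
    fun t ht => (hsm t ht).hasSum.tendsto_sum_nat.comp (tendsto_add_atTop_nat 2)
  have hlimR : ∀ t, 0 ≤ t → Tendsto (fun N => R N t) atTop (𝓝 0) := fun t ht => by
    simpa [hR] using ((hf.hasSum t ht).tendsto_sum_nat.comp (tendsto_add_atTop_nat 2)).const_sub μ
  have hlimD : ∀ t, 0 ≤ t → Tendsto (fun N => D N t) atTop (𝓝 0) := fun t ht => by
    have h1 := tendsto_sum_mul_of_antitone (w := fun k : ℕ => (k : ℝ)) (fun k => k.cast_nonneg)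
      (fun k => hf.nonneg k t ht) (hf.antitone t ht) (hsm t ht) (hf.tendsto_zero ht)
    have h2 := (h1.comp (tendsto_add_atTop_nat 2)).const_mul 2
    rw [mul_zero] at h2
    refine h2.congr fun N => ?_
    have h3 : ∀ M : ℕ, 2 * ∑ k ∈ Finset.range M, (k : ℝ) = M * (M - 1) := fun M => by
      induction M with
      | zero => simp
      | succ M ih => rw [Finset.sum_range_succ, mul_add, ih]; push_cast; ring
    simp only [Function.comp, hD]
    rw [← mul_assoc, h3]
    push_cast; ring
  -- Inserting `a ≤ 2 S + R` turns `-2 S + μ a` into `-c S + μ R`; the weight `exp (c * t)` cancels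
  -- `-c S` and only vanishing terms remain.
  have key := sub_le_sub_of_tendsto_deriv_right_le hT
    (F := fun N t => Real.exp (c * t) * S N t)
    (E := fun N t => Real.exp (c * t) * (D N t + μ * R N t))
    (g := fun _ => 0) (g' := fun _ => 0) (B := Real.exp (|c| * T) * (2 * (V + μ ^ 2 * T) + μ * μ))
    (fun N => ContinuousOn.mul (by fun_prop) (hSc N))
    (fun N s hs => ((hexp s).hasDerivWithinAt.mul (hSd N s hs.1)).mono (Ici_subset_Ici.2 hs.1))
    continuousOn_const (fun s _ => hasDerivWithinAt_const _ _ _)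
    (fun N => ContinuousOn.mul (by fun_prop) ((continuousOn_const.mul (hhc _)).add
      (continuousOn_const.mul (continuousOn_const.sub (continuousOn_finsetSum _ fun k _ => hhc k)))))
    (fun N s hs => by
      have h1 := hDS N s hs.1
      have h2 := hf.sum_mul_le hV hs.1 (N + 2)
      have h3 : μ ^ 2 * s ≤ μ ^ 2 * T := mul_le_mul_of_nonneg_left hs.2 (by positivity)
      have h4 : R N s ≤ μ := by
        have := Finset.sum_nonneg fun k (_ : k ∈ Finset.range (N + 2)) => hf.nonneg k s hs.1
        simp only [hR]; linarith
      have h5 := hRnn N s hs.1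
      have h6 := hDnn N s hs.1
      rw [abs_of_nonneg (by positivity)]
      have h7 : c * s ≤ |c| * T := by
        refine (le_abs_self _).trans ?_
        rw [abs_mul, abs_of_nonneg hs.1]
        exact mul_le_mul_of_nonneg_left hs.2 (abs_nonneg c)
      refine mul_le_mul (Real.exp_le_exp.2 h7) ?_ (by positivity) (by positivity)
      have h8 : μ * R N s ≤ μ * μ := mul_le_mul_of_nonneg_left h4 hμ
      have h9 : S N s ≤ V + μ ^ 2 * s := h2
      linarith)
    (fun s hs => by
      simpa using ((hlimD s hs.1).add ((hlimR s hs.1).const_mul μ)).const_mul (Real.exp (c * s)))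
    (fun N s hs => by
      have h1 := hf.active_le_two_mul_sum N hs.1
      have h2 : a s * (∑ k ∈ Finset.range (N + 1), h k s - (N + 1) * h (N + 1) s) ≤ a s * μ := by
        refine mul_le_mul_of_nonneg_left ?_ (hf.active_nonneg hs.1)
        have h3 := hf.sum_le hs.1 (N + 1)
        have h4 : 0 ≤ ((N : ℝ) + 1) * h (N + 1) s := mul_nonneg (by positivity)
          (hf.nonneg _ s hs.1)
        linarith
      have h5 : a s * μ ≤ (2 * S N s + R N s) * μ := mul_le_mul_of_nonneg_right h1 hμ
      rw [add_zero, mul_assoc, ← mul_add]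
      refine mul_le_mul_of_nonneg_left ?_ (Real.exp_pos _).le
      rw [hc]
      linarith)
    ((hlimS 0 le_rfl).const_mul _) ((hlimS T hT).const_mul _)
  have h0 : ∑' k : ℕ, (k : ℝ) * h k 0 ≤ V :=
    Real.tsum_le_of_sum_range_le (fun k => hw k 0 le_rfl) hV
  have h1 : a T ≤ 2 * ∑' k : ℕ, (k : ℝ) * h k T :=
    ge_of_tendsto' (by simpa using ((hlimS T hT).const_mul 2).add (hlimR T hT))
      fun N => hf.active_le_two_mul_sum N hT
  have h2 : Real.exp (-2 * (1 - μ) * T) = (Real.exp (c * T))⁻¹ := by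
    rw [← Real.exp_neg, hc]; ring_nf
  simp only [mul_zero, Real.exp_zero, one_mul, sub_zero] at key
  rw [h2, ← div_eq_mul_inv, le_div_iff₀ (Real.exp_pos _)]
  have := Real.exp_pos (c * T)
  nlinarith

theorem empty_antitoneOn : AntitoneOn (fun s => 1 - h 0 s) (Ici 0) := by
  refine antitoneOn_of_deriv_nonpos (convex_Ici 0) (continuousOn_const.sub (hf.continuousOn 0))
    (fun s hs => ?_) (fun s hs => ?_) <;>
  · rw [interior_Ici] at hs
    have hs' : (0 : ℝ) ≤ s := (mem_Ioi.1 hs).le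
    have hd := (hf.deriv_empty hs').hasDerivAt (Ici_mem_nhds hs)
    first
    | exact hd.differentiableAt.differentiableWithinAt
    | rw [hd.deriv]
      exact neg_nonpos.2 (mul_nonneg (hf.active_nonneg hs') (sub_nonneg.2 (hf.le_one s hs')))

theorem active_le_two_mul_empty (hμ : μ = 1) {t : ℝ} (ht : 0 ≤ t) : a t ≤ 2 * (1 - h 0 t) := by
  have h1 := hf.sum_le ht 2
  simp only [Finset.sum_range_succ, Finset.range_zero, Finset.sum_empty, zero_add] at h1
  rw [hf.active_eq t ht]; linarith

/-- Here `a = (1 - h 0) + h 1 ≥ 1 - h 0`, so the reciprocal of the empty fraction grows at rate at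
least `1`. -/
theorem empty_le_inv (hμ : μ = 1) {T : ℝ} (hT : 0 < T) : 1 - h 0 T ≤ T⁻¹ := by
  by_cases hpos : 1 - h 0 T ≤ 0
  · exact hpos.trans (inv_pos.2 hT).le
  push Not at hpos
  have hps : ∀ s ∈ Icc 0 T, 0 < 1 - h 0 s := fun s hs =>
    hpos.trans_le (hf.empty_antitoneOn hs.1 (mem_Ici.2 hT.le) hs.2)
  have hd : ∀ s ∈ Icc 0 T, HasDerivWithinAt (fun s => (1 - h 0 s)⁻¹)
      (-(-(a s * (1 - h 0 s))) / (1 - h 0 s) ^ 2) (Ici 0) s := fun s hs =>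
    (hf.deriv_empty hs.1).fun_inv (hps s hs).ne'
  have := sub_le_sub_of_deriv_right_le hT.le (f := fun s => s) (f' := fun _ => 1)
    continuousOn_id (fun s _ => hasDerivWithinAt_id s _)
    (fun s hs => (hd s hs).continuousWithinAt.mono Icc_subset_Ici_self)
    (fun s hs => (hd s ⟨hs.1, hs.2.le⟩).mono (Ici_subset_Ici.2 hs.1))
    (fun s hs => by
      have h1 := hps s ⟨hs.1, hs.2.le⟩
      have h2 := hf.nonneg 1 s hs.1
      have h3 := hf.active_eq s hs.1
      rw [le_div_iff₀ (by positivity)]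
      nlinarith)
  have h0 : 0 < (1 - h 0 0)⁻¹ := inv_pos.2 (hps 0 ⟨le_rfl, hT.le⟩)
  rw [le_inv_comm₀ hpos hT]
  simp only [sub_zero] at this
  linarith

end TailFlow

/-- Only the site `n = 1` carries a deficit relative to the Bernoulli law, namely `μ - p t 1`, which
is the activity; the excess elsewhere has the same total. -/
theorem IsSolutionFrom.ell1Dist_bernoulliLaw {μ : ℝ} {p0 : ℕ → ℝ} {p : ℝ → ℕ → ℝ}
    (hp : IsSolutionFrom p0 μ p) {t : ℝ} (ht : 0 ≤ t) :
    ell1Dist (p t) (bernoulliLaw μ) = 2 * activeAlong μ p t := by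
  have hd := hp.solution.isDistribution t ht
  have hf := hp.tailFlow
  have ha := hf.active_eq t ht
  have h0 := tail_zero (p t)
  have h1 := tail_succ (p t) 0
  have h2 : HasSum (fun n => |p t (n + 2) - bernoulliLaw μ (n + 2)|) (tail (p t) 1) := by
    refine (hd.hasSum_tail_shift 1).congr_fun fun n => ?_
    rw [show bernoulliLaw μ (n + 2) = 0 from rfl, sub_zero, abs_of_nonneg (hd.nonneg (n + 2))]
  have h3 : HasSum (fun n => |p t n - bernoulliLaw μ n|) (tail (p t) 1
      + ∑ n ∈ Finset.range 2, |p t n - bernoulliLaw μ n|) := (hasSum_nat_add_iff 2).1 h2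
  have h4 : 0 ≤ p t 0 - (1 - μ) := by
    have := hf.sum_le ht 1
    simp only [Finset.sum_range_one] at this
    linarith
  have h5 : p t 1 - μ ≤ 0 := by
    have := hf.active_nonneg ht
    linarith
  rw [ell1Dist, h3.tsum_eq]
  rw [Finset.sum_range_succ, Finset.sum_range_one, show bernoulliLaw μ 0 = 1 - μ from rfl,
    show bernoulliLaw μ 1 = μ from rfl, abs_of_nonneg h4, abs_of_nonpos h5, ha]
  linarith

theorem exists_bound_bernoulliLaw (m₂ : ℝ) : ∃ C : ℝ, 0 < C ∧
      ∀ (μ : ℝ) (p0 : ℕ → ℝ) (p : ℝ → ℕ → ℝ), IsSolutionFrom p0 μ p →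
        HasSum (fun n : ℕ => (n : ℝ) ^ 2 * p0 n) m₂ →
        (0 < μ → μ < 1 → ∀ t : ℝ, 0 ≤ t →
          ell1Dist (p t) (bernoulliLaw μ) ≤ C * Real.exp (-2 * (1 - μ) * t)) ∧
        (μ = 1 → ∀ t : ℝ, 0 < t → ell1Dist (p t) (bernoulliLaw μ) ≤ C * t⁻¹) := by
  -- The first summand serves `μ < 1`, where `V = m₂ / 2`; the `4` serves `μ = 1`, from `2 * a ≤ 4 *
  -- (1 - h 0)`.
  refine ⟨2 * |m₂| + 4, by positivity, fun μ p0 p hp hm => ⟨fun _ _ t ht => ?_, fun hμ t ht => ?_⟩⟩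
  · have h1 := hp.tailFlow.active_le_exp (V := m₂ / 2) (fun N => by
      rw [hp.initial_value]
      linarith [hp.initial_distribution.two_mul_sum_mul_tail_le hm N]) ht
    rw [hp.ell1Dist_bernoulliLaw ht]
    have h2 := Real.exp_pos (-2 * (1 - μ) * t)
    have h3 := le_abs_self m₂
    nlinarith
  · rw [hp.ell1Dist_bernoulliLaw ht.le]
    have h1 := hp.tailFlow.active_le_two_mul_empty hμ ht.le
    have h2 := hp.tailFlow.empty_le_inv hμ ht
    have h3 := mul_nonneg (abs_nonneg m₂) (inv_pos.2 ht).le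
    linarith

/-! ### Duality and the Volterra equation for the activity. -/

/-- The discounted activity `∫_s^T e^{r - T} a(r) dr`. -/
noncomputable def discounted (a : ℝ → ℝ) (T s : ℝ) : ℝ := ∫ r in s..T, Real.exp (r - T) * a r

section discounted

variable {a : ℝ → ℝ}

theorem hasDerivAt_discounted (ha : Continuous a) (T s : ℝ) :
    HasDerivAt (discounted a T) (-(Real.exp (s - T) * a s)) s := by
  have hc : Continuous fun r => Real.exp (r - T) * a r := by fun_prop
  exact intervalIntegral.integral_hasDerivAt_left (hc.intervalIntegrable _ _)
    hc.stronglyMeasurable.stronglyMeasurableAtFilter hc.continuousAt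

theorem continuous_discounted (ha : Continuous a) (T : ℝ) : Continuous (discounted a T) :=
  continuous_iff_continuousAt.2 fun s => (hasDerivAt_discounted ha T s).continuousAt

theorem discounted_self (T : ℝ) : discounted a T T = 0 := intervalIntegral.integral_same

theorem discounted_const (c T s : ℝ) :
    discounted (fun _ => c) T s = c * (1 - Real.exp (s - T)) := by
  rw [discounted, intervalIntegral.integral_mul_const,
    intervalIntegral.integral_comp_sub_right (fun x => Real.exp x), integral_exp]
  simp [mul_comm]

theorem discounted_mono {a' : ℝ → ℝ} (ha : Continuous a) (ha' : Continuous a') {s T : ℝ}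
    (hs : 0 ≤ s) (hsT : s ≤ T) (h : ∀ t, 0 ≤ t → a t ≤ a' t) :
    discounted a T s ≤ discounted a' T s := by
  refine intervalIntegral.integral_mono_on hsT (Continuous.intervalIntegrable (by fun_prop) _ _)
    (Continuous.intervalIntegrable (by fun_prop) _ _) fun r hr => ?_
  exact mul_le_mul_of_nonneg_left (h r (hs.trans hr.1)) (Real.exp_pos _).le

/-- For `θ ≤ 1` the product `exp (r - T) * exp (-θ * r)` is largest at `r = T`. This caps the decay
rate of the activity at `1`. -/
theorem abs_discounted_sub_le {a' : ℝ → ℝ} (ha : Continuous a) (ha' : Continuous a')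
    {s T D θ : ℝ} (hsT : s ≤ T) (hθ : θ ≤ 1)
    (h : ∀ t ∈ Icc s T, |a t - a' t| ≤ D * Real.exp (-θ * t)) :
    |discounted a T s - discounted a' T s| ≤ D * Real.exp (-θ * T) * (T - s) := by
  rw [discounted, discounted, ← intervalIntegral.integral_sub
    (Continuous.intervalIntegrable (by fun_prop) _ _)
    (Continuous.intervalIntegrable (by fun_prop) _ _), ← Real.norm_eq_abs,
    ← abs_of_nonneg (sub_nonneg.2 hsT)]
  refine intervalIntegral.norm_integral_le_of_norm_le_const fun r hr => ?_
  rw [uIoc_of_le hsT] at hr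
  have h1 := h r ⟨hr.1.le, hr.2⟩
  have hD : 0 ≤ D := nonneg_of_mul_nonneg_left ((abs_nonneg _).trans h1) (Real.exp_pos _)
  rw [← mul_sub, Real.norm_eq_abs, abs_mul, Real.abs_exp]
  calc Real.exp (r - T) * |a r - a' r| ≤ Real.exp (r - T) * (D * Real.exp (-θ * r)) := by gcongr
    _ = D * Real.exp ((r - T) + -θ * r) := by rw [Real.exp_add]; ring
    _ ≤ D * Real.exp (-θ * T) := by
      gcongr
      nlinarith [hr.2]

end discounted

/-- Solution of the adjoint of the tail equations whose value at time `T` is `-lam` at `0`, `1` at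
`1` and `0` elsewhere. -/
noncomputable def adjoint (lam : ℝ) (a : ℝ → ℝ) (T : ℝ) (k : ℕ) (s : ℝ) : ℝ :=
  Real.exp (-discounted a T s) *
    (Real.exp (s - T) ^ 2 * (k * (1 - Real.exp (s - T)) ^ (k - 1))
      + (discounted a T s - lam) * Real.exp (s - T) * (1 - Real.exp (s - T)) ^ k)

/-- With `x = exp (s - T)` and `b = discounted a T s`, the characteristics of the generating
function give the adjoint solution `exp (-b) * x * (1 - x) ^ k`. Replacing `(x, b)` by `(c x, c b)`
gives another one, and so does differentiation in `c` at `1`; `adjoint` combines the two. -/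
theorem hasDerivAt_adjoint {a : ℝ → ℝ} (ha : Continuous a) (lam T : ℝ) (k : ℕ) (s : ℝ) :
    HasDerivAt (adjoint lam a T k)
      (-(k * adjoint lam a T (k - 1) s - (k + 1 + a s) * adjoint lam a T k s
        + a s * adjoint lam a T (k + 1) s)) s := by
  have hb := hasDerivAt_discounted ha T s
  have he : HasDerivAt (fun s => Real.exp (s - T)) (Real.exp (s - T)) s := by
    simpa using ((hasDerivAt_id s).sub_const T).exp
  have hz := he.const_sub 1
  have hE := hb.neg.exp
  have hmain := hE.mul (((he.pow 2).mul ((hz.pow (k - 1)).const_mul (k : ℝ))).add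
    (((hb.sub_const lam).mul he).mul (hz.pow k)))
  refine hmain.congr_deriv ?_
  simp only [adjoint, Pi.neg_apply, Pi.mul_apply, Pi.add_apply, Pi.pow_apply]
  generalize discounted a T s = b
  generalize Real.exp (s - T) = x
  generalize Real.exp (-b) = E
  rcases k with _ | _ | k
  · simp; ring
  · simp; ring
  · simp only [Nat.add_sub_cancel]
    push_cast
    simp only [pow_succ]
    ring

theorem abs_adjoint_le {a : ℝ → ℝ} {lam M T s : ℝ} {k : ℕ} (hsT : s ≤ T)
    (h0 : 0 ≤ discounted a T s) (h1 : discounted a T s ≤ M) :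
    |adjoint lam a T k s| ≤ Real.exp (s - T) ^ 2 * (k * (1 - Real.exp (s - T)) ^ (k - 1))
      + (M + |lam|) * Real.exp (s - T) * (1 - Real.exp (s - T)) ^ k := by
  have hE : Real.exp (-discounted a T s) ≤ 1 := Real.exp_le_one_iff.2 (by linarith)
  have hx1 : Real.exp (s - T) ≤ 1 := Real.exp_le_one_iff.2 (by linarith)
  have hz : 0 ≤ 1 - Real.exp (s - T) := by linarith
  rw [adjoint, abs_mul, Real.abs_exp]
  refine (mul_le_of_le_one_left (abs_nonneg _) hE).trans ((abs_add_le _ _).trans ?_)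
  rw [abs_of_nonneg (by positivity)]
  gcongr
  rw [abs_mul, abs_mul, Real.abs_exp, abs_of_nonneg (pow_nonneg hz k)]
  gcongr
  refine (abs_sub _ _).trans ?_
  rw [abs_of_nonneg h0]
  linarith

/-- Each term of `∑ j < k, z ^ j` is at least `z ^ (k - 1)`. It bounds the adjoint at time `0` by a
multiple of `exp (-T)` uniformly in `k`, so the initial law enters only through its mean. -/
theorem nat_mul_pow_mul_one_sub_le {z : ℝ} (hz0 : 0 ≤ z) (hz1 : z ≤ 1) (k : ℕ) :
    k * z ^ (k - 1) * (1 - z) ≤ 1 - z ^ k := by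
  induction k with
  | zero => simp
  | succ k ih =>
    rcases k with _ | k
    · simp
    · simp only [Nat.add_sub_cancel] at ih ⊢
      push_cast at ih ⊢
      have h1 := mul_le_mul_of_nonneg_left ih hz0
      have h2 : z ^ (k + 1) ≤ 1 := pow_le_one₀ hz0 hz1
      have h3 : 0 ≤ z ^ k := pow_nonneg hz0 k
      simp only [pow_succ] at *
      nlinarith

/-- The nonlinearity of the Volterra equation for the activity. -/
noncomputable def gain (lam b : ℝ) : ℝ := (b - lam) * Real.exp (-b)

theorem adjoint_zero (lam : ℝ) (a : ℝ → ℝ) (T s : ℝ) :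
    adjoint lam a T 0 s = Real.exp (s - T) * gain lam (discounted a T s) := by
  simp [adjoint, gain]; ring

namespace TailFlow

variable {μ : ℝ} {a : ℝ → ℝ} {h : ℕ → ℝ → ℝ} (hf : TailFlow μ a h)
include hf

theorem discounted_nonneg {s T : ℝ} (hs : 0 ≤ s) (hsT : s ≤ T) : 0 ≤ discounted a T s := by
  have := discounted_mono continuous_const hf.continuous hs hsT fun t ht => hf.active_nonneg ht
  rwa [discounted_const, zero_mul] at this

theorem discounted_le {s T : ℝ} (hs : 0 ≤ s) (hsT : s ≤ T) : discounted a T s ≤ μ := by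
  have := discounted_mono hf.continuous continuous_const hs hsT fun t ht => hf.active_le ht
  rw [discounted_const] at this
  exact this.trans (mul_le_of_le_one_right hf.mean_nonneg (by linarith [Real.exp_pos (s - T)]))

/-- Duality cancels the interior terms; the source `μ` of the equation for `h 0` and two cut-off
fluxes remain. -/
theorem deriv_sum_adjoint (lam T : ℝ) (N : ℕ) {s : ℝ} (hs : 0 ≤ s) :
    HasDerivWithinAt (fun s => ∑ k ∈ Finset.range (N + 1), h k s * adjoint lam a T k s)
      (μ * adjoint lam a T 0 s + ((N : ℝ) + 1) * h (N + 1) s * adjoint lam a T N s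
        - a s * h N s * adjoint lam a T (N + 1) s) (Ici 0) s := by
  have hc := fun k => (hasDerivAt_adjoint hf.continuous lam T k s).hasDerivWithinAt (s := Ici 0)
  induction N with
  | zero =>
    simp only [zero_add, Finset.sum_range_one]
    refine ((hf.deriv_zero s hs).mul (hc 0)).congr_deriv ?_
    push_cast; ring
  | succ N ih =>
    have h1 : (fun s => ∑ k ∈ Finset.range (N + 1 + 1), h k s * adjoint lam a T k s)
        = (fun s => ∑ k ∈ Finset.range (N + 1), h k s * adjoint lam a T k s)
          + h (N + 1) * adjoint lam a T (N + 1) := by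
      funext s
      rw [Finset.sum_range_succ]; simp
    rw [h1]
    refine (ih.add ((hf.deriv_succ N s hs).mul (hc (N + 1)))).congr_deriv ?_
    simp only [Nat.add_sub_cancel]
    push_cast; ring

theorem abs_sum_adjoint_zero_le (lam : ℝ) {T : ℝ} (hT : 0 ≤ T) (N : ℕ) :
    |∑ k ∈ Finset.range N, h k 0 * adjoint lam a T k 0|
      ≤ μ * (1 + μ + |lam|) * Real.exp (-T) := by
  have hμ := hf.mean_nonneg
  have hc : ∀ k, |adjoint lam a T k 0| ≤ (1 + μ + |lam|) * Real.exp (-T) := fun k => by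
    have h1 := abs_adjoint_le (lam := lam) (k := k) hT (hf.discounted_nonneg le_rfl hT)
      (hf.discounted_le le_rfl hT)
    rw [zero_sub] at h1
    have hx0 := Real.exp_pos (-T)
    have hx1 : Real.exp (-T) ≤ 1 := Real.exp_le_one_iff.2 (by linarith)
    have hz0 : 0 ≤ 1 - Real.exp (-T) := by linarith
    have h2 := nat_mul_pow_mul_one_sub_le hz0 (by linarith) k
    have h3 : (1 - Real.exp (-T)) ^ k ≤ 1 := pow_le_one₀ hz0 (by linarith)
    have h4 := pow_nonneg hz0 k
    have h5 : (μ + |lam|) * Real.exp (-T) * (1 - Real.exp (-T)) ^ k ≤ (μ + |lam|) * Real.exp (-T) :=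
      mul_le_of_le_one_right (by positivity) h3
    have h6 : Real.exp (-T) ^ 2 * (k * (1 - Real.exp (-T)) ^ (k - 1)) ≤ Real.exp (-T) := by
      rw [sub_sub_cancel] at h2
      nlinarith
    linarith
  refine (Finset.abs_sum_le_sum_abs _ _).trans ?_
  calc ∑ k ∈ Finset.range N, |h k 0 * adjoint lam a T k 0|
      ≤ ∑ k ∈ Finset.range N, h k 0 * ((1 + μ + |lam|) * Real.exp (-T)) := by
        refine Finset.sum_le_sum fun k _ => ?_
        rw [abs_mul, abs_of_nonneg (hf.nonneg k 0 le_rfl)]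
        exact mul_le_mul_of_nonneg_left (hc k) (hf.nonneg k 0 le_rfl)
    _ ≤ μ * ((1 + μ + |lam|) * Real.exp (-T)) := by
        rw [← Finset.sum_mul]
        exact mul_le_mul_of_nonneg_right (hf.sum_le le_rfl N) (by positivity)
    _ = _ := by ring

/-- Volterra equation for the activity, with an error from the initial distribution. -/
theorem abs_sub_integral_gain_le (lam : ℝ) {T : ℝ} (hT : 0 ≤ T) :
    |h 1 T - lam * h 0 T - ∫ s in (0 : ℝ)..T, μ * (Real.exp (s - T) * gain lam (discounted a T s))|
      ≤ μ * (1 + μ + |lam|) * Real.exp (-T) := by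
  have hμ := hf.mean_nonneg
  have hbc := continuous_discounted hf.continuous T
  set φ : ℝ → ℝ := fun s => μ * (Real.exp (s - T) * gain lam (discounted a T s)) with hφ
  have hφc : Continuous φ := by
    simp only [hφ, gain]
    fun_prop
  have hg : ∀ s, HasDerivAt (fun s => ∫ r in (0 : ℝ)..s, φ r) (φ s) s := fun s =>
    intervalIntegral.integral_hasDerivAt_right (hφc.intervalIntegrable _ _)
      hφc.stronglyMeasurable.stronglyMeasurableAtFilter hφc.continuousAt
  set ζ : ℝ := 1 - Real.exp (-T) with hζ
  have hζ0 : 0 ≤ ζ := sub_nonneg.2 (Real.exp_le_one_iff.2 (by linarith))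
  have hζ1 : ζ < 1 := by linarith [Real.exp_pos (-T)]
  -- A bound for the adjoint uniform on `[0, T]`. As it tends to `0`, the cut-off fluxes vanish
  -- using only `N * h N ≤ μ`.
  set κ : ℕ → ℝ := fun k => k * ζ ^ (k - 1) + (μ + |lam|) * ζ ^ k with hκ
  have hκ0 : ∀ k, 0 ≤ κ k := fun k => by positivity
  have hκlim : Tendsto (fun N => μ * κ (N + 1) + μ * κ (N + 2)) atTop (𝓝 0) := by
    have h1 := tendsto_self_mul_const_pow_of_lt_one hζ0 hζ1
    have h2 := tendsto_pow_atTop_nhds_zero_of_lt_one hζ0 hζ1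
    have h3 : Tendsto (fun N => κ (N + 1)) atTop (𝓝 0) := by
      have := (h1.add h2).add ((h2.comp (tendsto_add_atTop_nat 1)).const_mul (μ + |lam|))
      simp only [mul_zero, add_zero] at this
      refine this.congr fun N => ?_
      simp only [hκ, Function.comp, Nat.add_sub_cancel]
      push_cast; ring
    have h4 : Tendsto (fun N => κ (N + 2)) atTop (𝓝 0) :=
      h3.comp (tendsto_add_atTop_nat 1)
    simpa using (h3.const_mul μ).add (h4.const_mul μ)
  have hc : ∀ k, ∀ s ∈ Icc 0 T, |adjoint lam a T k s| ≤ κ k := fun k s hs => by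
    refine (abs_adjoint_le hs.2 (hf.discounted_nonneg hs.1 hs.2)
      (hf.discounted_le hs.1 hs.2)).trans ?_
    have hx0 := Real.exp_pos (s - T)
    have hx1 : Real.exp (s - T) ≤ 1 := Real.exp_le_one_iff.2 (by linarith [hs.2])
    have hz0 : 0 ≤ 1 - Real.exp (s - T) := by linarith
    have hz1 : 1 - Real.exp (s - T) ≤ ζ := by
      have : Real.exp (-T) ≤ Real.exp (s - T) := Real.exp_le_exp.2 (by linarith [hs.1])
      linarith
    simp only [hκ]
    refine add_le_add ((mul_le_of_le_one_left (by positivity) (pow_le_one₀ hx0.le hx1)).trans ?_) ?_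
    · gcongr
    · refine mul_le_mul (mul_le_of_le_one_right (by positivity) hx1) ?_ (by positivity)
        (by positivity)
      gcongr
  have hT1 : ∀ N : ℕ, ∑ k ∈ Finset.range (N + 2), h k T * adjoint lam a T k T
      = h 1 T - lam * h 0 T := fun N => by
    have h1 : ∀ k, adjoint lam a T (k + 1 + 1) T = 0 := fun k => by
      simp [adjoint, discounted_self]
    rw [Finset.sum_range_succ', Finset.sum_range_succ']
    simp only [h1]
    simp [adjoint, discounted_self]
    ring
  have hstep : ∀ N : ℕ, |h 1 T - lam * h 0 T - ∫ s in (0 : ℝ)..T, φ s|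
      ≤ μ * (1 + μ + |lam|) * Real.exp (-T) + (μ * κ (N + 1) + μ * κ (N + 2)) * T := fun N => by
    have hd := fun s (hs : s ∈ Ico 0 T) =>
      (hf.deriv_sum_adjoint lam T (N + 1) hs.1).mono (Ici_subset_Ici.2 hs.1)
    have hcont : ContinuousOn
        (fun s => ∑ k ∈ Finset.range (N + 1 + 1), h k s * adjoint lam a T k s) (Icc 0 T) :=
      fun s hs => (hf.deriv_sum_adjoint lam T (N + 1) hs.1).continuousWithinAt.mono
        Icc_subset_Ici_self
    have hgc : Continuous fun s => ∫ r in (0 : ℝ)..s, φ r :=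
      continuous_iff_continuousAt.2 fun s => (hg s).continuousAt
    have hbd : ∀ s ∈ Ico 0 T, |((N + 1 : ℕ) + 1 : ℝ) * h (N + 1 + 1) s * adjoint lam a T (N + 1) s
        - a s * h (N + 1) s * adjoint lam a T (N + 1 + 1) s| ≤ μ * κ (N + 1) + μ * κ (N + 2) :=
      fun s hs => by
        have hs' : s ∈ Icc 0 T := ⟨hs.1, hs.2.le⟩
        refine (abs_sub _ _).trans (add_le_add ?_ ?_)
        · have h1 := hf.mul_le hs.1 (N + 2)
          have h2 := hf.nonneg (N + 2) s hs.1
          push_cast at h1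
          rw [abs_mul, abs_of_nonneg (by positivity)]
          refine mul_le_mul ?_ (hc _ s hs') (abs_nonneg _) hμ
          push_cast; linarith
        · have h2 := hf.nonneg (N + 1) s hs.1
          have h3 : h (N + 1) s ≤ 1 := (hf.antitone s hs.1 (Nat.zero_le _)).trans (hf.le_one s hs.1)
          have h4 := hf.active_nonneg hs.1
          rw [abs_mul, abs_of_nonneg (by positivity)]
          refine mul_le_mul ?_ (hc _ s hs') (abs_nonneg _) hμ
          exact (mul_le_of_le_one_right h4 h3).trans (hf.active_le hs.1)
    have hl : ∀ s, HasDerivAt (fun s => (μ * κ (N + 1) + μ * κ (N + 2)) * s)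
        (μ * κ (N + 1) + μ * κ (N + 2)) s := fun s => by
      simpa using (hasDerivAt_id s).const_mul (μ * κ (N + 1) + μ * κ (N + 2))
    have hu := sub_le_sub_of_deriv_right_le hT hcont hd
      (hgc.continuousOn.add (by fun_prop))
      (fun s _ => ((hg s).add (hl s)).hasDerivWithinAt)
      (fun s hs => by
        rw [adjoint_zero]
        have := (abs_le.1 (hbd s hs)).2
        simp only [hφ] at this ⊢
        linarith)
    have hlo := sub_le_sub_of_deriv_right_le hT
      (hgc.continuousOn.sub (f := fun s => ∫ r in (0 : ℝ)..s, φ r)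
        (g := fun s => (μ * κ (N + 1) + μ * κ (N + 2)) * s) (by fun_prop))
      (fun s _ => ((hg s).sub (hl s)).hasDerivWithinAt) hcont hd
      (fun s hs => by
        rw [adjoint_zero]
        have := (abs_le.1 (hbd s hs)).1
        simp only [hφ] at this ⊢
        linarith)
    have h0 := abs_le.1 (hf.abs_sum_adjoint_zero_le lam hT (N + 1 + 1))
    simp only [Pi.add_apply, Pi.sub_apply, hT1, intervalIntegral.integral_same, mul_zero, sub_zero,
      add_zero] at hu hlo
    rw [abs_le]
    constructor <;> linarith [h0.1, h0.2]
  refine ge_of_tendsto' (x := atTop) (f := fun N => μ * (1 + μ + |lam|) * Real.exp (-T)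
    + (μ * κ (N + 1) + μ * κ (N + 2)) * T) ?_ hstep
  simpa using (hκlim.mul_const T).const_add (μ * (1 + μ + |lam|) * Real.exp (-T))

end TailFlow

/-! ### The parameter `ν` and the stationary law. -/

/-- Strict convexity of `exp` on `[-y, 0]`. It decides on which side of the fixed point `ν = μ * (1
- exp (-ν))` a number lies. -/
theorem one_sub_exp_neg_div_lt {x y : ℝ} (hx : 0 < x) (hxy : x < y) :
    x * (1 - Real.exp (-y)) < y * (1 - Real.exp (-x)) := by
  have hy : 0 < y := hx.trans hxy
  have h1 : 0 < 1 - x / y := sub_pos.2 ((div_lt_one hy).2 hxy)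
  have h2 := strictConvexOn_exp.2 (mem_univ (0 : ℝ)) (mem_univ (-y)) (by linarith) h1
    (div_pos hx hy) (by ring)
  simp only [smul_eq_mul, mul_zero, zero_add, Real.exp_zero, mul_one] at h2
  rw [show x / y * -y = -x by field_simp] at h2
  have h3 := mul_lt_mul_of_pos_left h2 hy
  have h4 : y * (1 - x / y + x / y * Real.exp (-y)) = y - x + x * Real.exp (-y) := by
    field_simp
  linarith

theorem nu_spec {μ : ℝ} (hμ : 1 < μ) :
    μ - 1 < nu μ ∧ nu μ < μ ∧ nu μ = μ * (1 - Real.exp (-nu μ)) := by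
  have hlt : μ * Real.exp (-μ) < Real.exp (-1) := by
    have h1 := Real.add_one_lt_exp (x := μ - 1) (by linarith)
    have h2 : Real.exp (-1) = Real.exp (μ - 1) * Real.exp (-μ) := by
      rw [← Real.exp_add]; ring_nf
    rw [h2]
    exact mul_lt_mul_of_pos_right (by linarith) (Real.exp_pos _)
  have hpos : 0 < μ * Real.exp (-μ) := by positivity
  have hex : ∃ y ∈ Ici (-1 : ℝ), y * Real.exp y = -μ * Real.exp (-μ) := by
    have := intermediate_value_Icc (a := (-1 : ℝ)) (b := 0) (by norm_num)
      (f := fun y => y * Real.exp y) (by fun_prop)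
    obtain ⟨y, hy, hy'⟩ := this (show -μ * Real.exp (-μ) ∈ _ from ⟨by linarith, by linarith⟩)
    exact ⟨y, hy.1, hy'⟩
  have h1 : -1 ≤ lambertW0 (-μ * Real.exp (-μ)) := Function.invFunOn_mem hex
  have h2 : lambertW0 (-μ * Real.exp (-μ)) * Real.exp (lambertW0 (-μ * Real.exp (-μ)))
      = -μ * Real.exp (-μ) := Function.invFunOn_eq hex
  rw [nu]
  set y := lambertW0 (-μ * Real.exp (-μ))
  -- The value `-exp (-1)` of `y * exp y` at `-1` is excluded by `hlt`; hence the strict bound `μ -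
  -- 1 < ν`.
  have hne : -1 ≠ y := by
    rintro h
    rw [← h] at h2
    linarith
  have hlt1 : -1 < y := lt_of_le_of_ne h1 hne
  have hneg : y < 0 := by
    by_contra hy
    have := mul_nonneg (not_lt.1 hy) (Real.exp_pos y).le
    linarith
  refine ⟨by linarith, by linarith, ?_⟩
  have h3 : Real.exp (-(μ + y)) = Real.exp (-μ) * (Real.exp y)⁻¹ := by
    rw [← Real.exp_neg, ← Real.exp_add]; ring_nf
  have h4 : y = -μ * Real.exp (-μ) * (Real.exp y)⁻¹ := by
    rw [← h2]; field_simp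
  rw [h3]
  linarith

theorem nu_pos {μ : ℝ} (hμ : 1 < μ) : 0 < nu μ := by
  linarith [(nu_spec hμ).1]

theorem nu_lt_one {μ : ℝ} (hμ : 1 < μ) (h : μ < Real.exp 1 / (Real.exp 1 - 1)) : nu μ < 1 := by
  obtain ⟨-, -, h3⟩ := nu_spec hμ
  have he : 1 < Real.exp 1 := Real.one_lt_exp_iff.2 one_pos
  rw [lt_div_iff₀ (by linarith)] at h
  have h4 : μ * (1 - Real.exp (-1)) < 1 := by
    rw [Real.exp_neg]
    have : μ * (1 - (Real.exp 1)⁻¹) = μ * (Real.exp 1 - 1) / Real.exp 1 := by field_simp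
    rw [this, div_lt_one (by linarith)]
    exact h
  by_contra hν
  rcases (not_lt.1 hν).eq_or_lt with h5 | h5
  · rw [← h5] at h3; linarith
  · have h6 := one_sub_exp_neg_div_lt one_pos h5
    have h7 := mul_lt_mul_of_pos_left h6 (by linarith : 0 < μ)
    nlinarith

theorem one_le_nu {μ : ℝ} (hμ : 1 < μ) (h : Real.exp 1 / (Real.exp 1 - 1) ≤ μ) : 1 ≤ nu μ := by
  obtain ⟨-, -, h3⟩ := nu_spec hμ
  have he : 1 < Real.exp 1 := Real.one_lt_exp_iff.2 one_pos
  rw [div_le_iff₀ (by linarith)] at h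
  have h4 : 1 ≤ μ * (1 - Real.exp (-1)) := by
    rw [Real.exp_neg]
    have : μ * (1 - (Real.exp 1)⁻¹) = μ * (Real.exp 1 - 1) / Real.exp 1 := by field_simp
    rw [this, one_le_div (by linarith)]
    exact h
  by_contra hν
  have h6 := one_sub_exp_neg_div_lt (nu_pos hμ) (not_le.1 hν)
  have h7 := mul_lt_mul_of_pos_left h6 (by linarith : 0 < μ)
  have h8 := nu_pos hμ
  nlinarith

section TruncatedPoisson

variable {ν : ℝ} (hν : 0 < ν)
include hν

theorem exp_sub_one_pos : 0 < Real.exp ν - 1 := sub_pos.2 (Real.one_lt_exp_iff.2 hν)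

theorem hasSum_truncatedPoisson : HasSum (truncatedPoisson ν) 1 := by
  have h1 : HasSum (fun n : ℕ => ν ^ n / (n.factorial : ℝ)) (Real.exp ν) := by
    rw [Real.exp_eq_exp_ℝ]; exact NormedSpace.expSeries_div_hasSum_exp ν
  have h2 := ((hasSum_nat_add_iff' 1).2 h1).mul_right (1 / (Real.exp ν - 1))
  have h3 : HasSum (fun n => truncatedPoisson ν (n + 1)) (1 - ∑ i ∈ Finset.range 1, truncatedPoisson ν i) := by
    have h4 := (exp_sub_one_pos hν).ne'
    have h5 : 1 - ∑ i ∈ Finset.range 1, truncatedPoisson ν i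
        = (Real.exp ν - ∑ i ∈ Finset.range 1, ν ^ i / (i.factorial : ℝ))
          * (1 / (Real.exp ν - 1)) := by
      simp [truncatedPoisson, h4]
    rw [h5]
    exact h2
  exact (hasSum_nat_add_iff' 1).1 h3

theorem isDistribution_truncatedPoisson : IsDistribution (truncatedPoisson ν) := by
  have h0 : ∀ n, 0 ≤ truncatedPoisson ν n := fun n => by
    have := exp_sub_one_pos hν
    rcases n with _ | n
    · exact le_rfl
    · simp only [truncatedPoisson]; positivity
  exact ⟨h0, fun n => le_hasSum (hasSum_truncatedPoisson hν) n fun k _ => h0 k,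
    hasSum_truncatedPoisson hν⟩

theorem hasSum_mul_truncatedPoisson :
    HasSum (fun n : ℕ => (n : ℝ) * truncatedPoisson ν n)
      (ν * Real.exp ν * (1 / (Real.exp ν - 1))) := by
  have h1 : HasSum (fun n : ℕ => ν ^ n / (n.factorial : ℝ)) (Real.exp ν) := by
    rw [Real.exp_eq_exp_ℝ]; exact NormedSpace.expSeries_div_hasSum_exp ν
  refine (hasSum_nat_add_iff' 1).1 ?_
  simp only [Finset.sum_range_one, Nat.cast_zero, zero_mul, sub_zero]
  refine ((h1.mul_left ν).mul_right (1 / (Real.exp ν - 1))).congr_fun fun n => ?_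
  simp only [truncatedPoisson, Nat.factorial_succ, pow_succ]
  push_cast
  have : (n.factorial : ℝ) ≠ 0 := by positivity
  field_simp

omit hν in
theorem truncatedPoisson_balance (k : ℕ) :
    ((k : ℝ) + 2) * truncatedPoisson ν (k + 2) = ν * truncatedPoisson ν (k + 1) := by
  simp only [truncatedPoisson, Nat.factorial_succ (k + 1), pow_succ]
  push_cast
  have : ((k + 1).factorial : ℝ) ≠ 0 := by positivity
  field_simp
  ring

end TruncatedPoisson

/-- The truncated Poisson law is stationary. -/
theorem tailFlow_truncatedPoisson {μ : ℝ} (hμ : 1 < μ) :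
    TailFlow μ (fun _ => nu μ) (fun k _ => tail (truncatedPoisson (nu μ)) k) := by
  have hν := nu_pos hμ
  obtain ⟨-, -, h3⟩ := nu_spec hμ
  have hd := isDistribution_truncatedPoisson hν
  have he := exp_sub_one_pos hν
  rw [Real.exp_neg] at h3
  have hmean : nu μ * Real.exp (nu μ) * (1 / (Real.exp (nu μ) - 1)) = μ := by
    nth_rw 1 [h3]
    field_simp
  have h0 : tail (truncatedPoisson (nu μ)) 0 = 1 := by simp [tail_zero, truncatedPoisson]
  have h1 : tail (truncatedPoisson (nu μ)) 1 = 1 - (μ - nu μ) := by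
    have h2 : truncatedPoisson (nu μ) 1 = nu μ * (1 / (Real.exp (nu μ) - 1)) := by
      simp [truncatedPoisson]
    have h4 : nu μ * Real.exp (nu μ) * (1 / (Real.exp (nu μ) - 1)) - nu μ
        = nu μ * (1 / (Real.exp (nu μ) - 1)) := by
      field_simp; ring
    rw [tail_succ, h0, h2]
    linarith
  have hs : HasSum (tail (truncatedPoisson (nu μ))) μ := by
    have := hd.hasSum_tail (hasSum_mul_truncatedPoisson hν)
    rwa [hmean] at this
  refine ⟨continuous_const, fun t _ => ?_, fun k t _ => ?_, fun t _ => hd.tail_antitone,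
    fun k t _ => hd.tail_nonneg k, fun t _ => hd.tail_le_one, fun t _ => hs, fun t _ => ?_⟩
  · refine (hasDerivWithinAt_const _ _ _).congr_deriv ?_
    rw [h0, h1]; ring
  · refine (hasDerivWithinAt_const _ _ _).congr_deriv ?_
    rw [tail_succ _ (k + 1), tail_succ _ k]
    linear_combination truncatedPoisson_balance (ν := nu μ) k
  · rw [h0, h1]; ring

/-! ### The nonlinearity and its contraction constant. -/

theorem hasDerivAt_gain (lam b : ℝ) :
    HasDerivAt (gain lam) ((1 + lam - b) * Real.exp (-b)) b := by
  have h1 := ((hasDerivAt_id b).sub_const lam).mul (hasDerivAt_id b).neg.exp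
  refine h1.congr_deriv ?_
  simp only [Pi.neg_apply, id]; ring

/-- The choice `lam = μ - 1` makes the derivative `(μ - b) * exp (-b)`, which is nonnegative and
decreasing for `b ≤ μ`, the range of `discounted`. -/
theorem abs_gain_sub_le {μ l x y : ℝ} (hx : x ∈ Icc l μ) (hy : y ∈ Icc l μ) :
    |gain (μ - 1) x - gain (μ - 1) y| ≤ (μ - l) * Real.exp (-l) * |x - y| := by
  refine Convex.norm_image_sub_le_of_norm_hasDerivWithin_le (s := Icc l μ)
    (fun b _ => (hasDerivAt_gain (μ - 1) b).hasDerivWithinAt) (fun b hb => ?_) (convex_Icc l μ) hy hx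
  have h1 : 1 + (μ - 1) - b = μ - b := by ring
  rw [h1, Real.norm_eq_abs, abs_of_nonneg (mul_nonneg (sub_nonneg.2 hb.2) (Real.exp_pos _).le)]
  have h2 := hb.1
  have h3 := sub_nonneg.2 hb.2
  gcongr
  linarith

theorem gain_monotoneOn (μ : ℝ) : MonotoneOn (gain (μ - 1)) (Iic μ) := by
  have hd := hasDerivAt_gain (μ - 1)
  refine monotoneOn_of_deriv_nonneg (convex_Iic μ) (fun b _ => (hd b).continuousAt.continuousWithinAt)
    (fun b _ => (hd b).differentiableAt.differentiableWithinAt) fun b hb => ?_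
  rw [interior_Iic] at hb
  rw [(hd b).deriv]
  exact mul_nonneg (by linarith [mem_Iio.1 hb]) (Real.exp_pos _).le

theorem hasDerivAt_exp_sub (T s : ℝ) :
    HasDerivAt (fun s => Real.exp (s - T)) (Real.exp (s - T)) s := by
  simpa using ((hasDerivAt_id s).sub_const T).exp

theorem integral_gain_const {μ m : ℝ} (hm : 0 < m) (T : ℝ) :
    ∫ s in (0 : ℝ)..T, μ * (Real.exp (s - T) * gain (μ - 1) (m * (1 - Real.exp (s - T))))
      = μ / m * ((2 - μ)
        - (m * (1 - Real.exp (-T)) + 2 - μ) * Real.exp (-(m * (1 - Real.exp (-T))))) := by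
  have hd : ∀ s, HasDerivAt (fun s => μ / m * ((m * (1 - Real.exp (s - T)) + (2 - μ))
      * Real.exp (-(m * (1 - Real.exp (s - T))))))
      (μ * (Real.exp (s - T) * gain (μ - 1) (m * (1 - Real.exp (s - T))))) s := fun s => by
    have hu := ((hasDerivAt_exp_sub T s).const_sub 1).const_mul m
    refine (((hu.add_const (2 - μ)).mul hu.fun_neg.exp).const_mul (μ / m)).congr_deriv ?_
    simp only [gain]
    field_simp
    ring
  rw [intervalIntegral.integral_eq_sub_of_hasDerivAt (fun s _ => hd s)
    (Continuous.intervalIntegrable (by simp only [gain]; fun_prop) _ _)]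
  simp only [sub_self, Real.exp_zero, mul_zero, neg_zero, mul_one, zero_sub]
  ring

/-- The contraction constant of the Volterra equation in exponentially weighted norms when the
activity is at least `m`. -/
noncomputable def contraction (μ m : ℝ) : ℝ :=
  μ * Real.exp (-m) * ((Real.exp m - 1) / m - (1 - μ + m))

theorem integral_slope_le {μ m : ℝ} (hm : 0 < m) (hm1 : μ - 1 ≤ m) (hmμ : m ≤ μ) {T : ℝ}
    (hT : 0 ≤ T) :
    ∫ s in (0 : ℝ)..T, μ * (Real.exp (s - T) * (T - s)
        * ((μ - m * (1 - Real.exp (s - T))) * Real.exp (-(m * (1 - Real.exp (s - T))))))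
      ≤ contraction μ m := by
  have hμ : 0 < μ := hm.trans_le hmμ
  -- `H` is the primitive of `(μ - m + m x) * exp (m x)` with `H 0 = 0`. With `x = exp (s - T)`,
  -- integration by parts removes the factor `T - s` and leaves `∫ H x / x`, which `hHle` bounds by
  -- an elementary integral; `V` encodes both steps.
  set H : ℝ → ℝ := fun x => x * Real.exp (m * x) - (1 - μ + m) * ((Real.exp (m * x) - 1) / m) with hH
  have hHle : ∀ x, 0 ≤ x → H x ≤ x * Real.exp (m * x) - (1 - μ + m) * x := fun x hx => by
    have h1 := Real.add_one_le_exp (m * x)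
    have h2 : x ≤ (Real.exp (m * x) - 1) / m := by rw [le_div_iff₀ hm]; linarith
    have h3 : 0 ≤ 1 - μ + m := by linarith
    simp only [hH]
    nlinarith
  have hH0 : ∀ x, 0 ≤ x → 0 ≤ H x := fun x hx => by
    have h1 := Real.add_one_le_exp (-(m * x))
    have h2 : Real.exp (m * x) * Real.exp (-(m * x)) = 1 := by rw [← Real.exp_add]; simp
    have h4 : 0 ≤ (Real.exp (m * x) - 1) / m :=
      div_nonneg (by linarith [Real.add_one_le_exp (m * x), mul_nonneg hm.le hx]) hm.le
    have h3 : (Real.exp (m * x) - 1) / m ≤ x * Real.exp (m * x) := by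
      rw [div_le_iff₀ hm]
      nlinarith [Real.exp_pos (m * x)]
    simp only [hH]
    nlinarith
  set V : ℝ → ℝ := fun s => μ * Real.exp (-m) * ((T - s) * H (Real.exp (s - T))
    + (Real.exp (m * Real.exp (s - T)) / m - (1 - μ + m) * Real.exp (s - T))) with hV
  have hVd : ∀ s, HasDerivAt V (μ * Real.exp (-m) * (-H (Real.exp (s - T))
      + (T - s) * ((μ - m + m * Real.exp (s - T)) * Real.exp (m * Real.exp (s - T)) * Real.exp (s - T))
      + (Real.exp (m * Real.exp (s - T)) * Real.exp (s - T) - (1 - μ + m) * Real.exp (s - T)))) s :=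
    fun s => by
      have hx := hasDerivAt_exp_sub T s
      have hmx := (hx.const_mul m).exp
      have hHd : HasDerivAt (fun s => H (Real.exp (s - T)))
          ((μ - m + m * Real.exp (s - T)) * Real.exp (m * Real.exp (s - T)) * Real.exp (s - T)) s := by
        refine ((hx.mul hmx).sub (((hmx.sub_const 1).div_const m).const_mul (1 - μ + m))).congr_deriv ?_
        field_simp
        ring
      have ht : HasDerivAt (fun s => T - s) (-1) s := (hasDerivAt_id s).const_sub T
      refine (((ht.mul hHd).add ((hmx.div_const m).sub (hx.const_mul (1 - μ + m)))).const_mul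
        (μ * Real.exp (-m))).congr_deriv ?_
      field_simp
  have hVc : Continuous V := continuous_iff_continuousAt.2 fun s => (hVd s).continuousAt
  have key := intervalIntegral.integral_le_sub_of_hasDeriv_right_of_le hT hVc.continuousOn
    (fun s _ => (hVd s).hasDerivWithinAt)
    (φ := fun s => μ * (Real.exp (s - T) * (T - s)
        * ((μ - m * (1 - Real.exp (s - T))) * Real.exp (-(m * (1 - Real.exp (s - T)))))))
    (Continuous.integrableOn_Icc (by fun_prop)) (fun s _ => by
      have h1 := hHle _ (Real.exp_pos (s - T)).le
      have h2 : Real.exp (-(m * (1 - Real.exp (s - T))))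
          = Real.exp (-m) * Real.exp (m * Real.exp (s - T)) := by
        rw [← Real.exp_add]; ring_nf
      have h3 : 0 ≤ μ * Real.exp (-m) := by positivity
      have h4 := mul_le_mul_of_nonneg_left h1 h3
      rw [h2]
      linarith)
  refine key.trans ?_
  simp only [hV, contraction, sub_self, Real.exp_zero, zero_mul, zero_add, mul_one, sub_zero,
    zero_sub]
  rw [← mul_sub]
  refine mul_le_mul_of_nonneg_left ?_ (by positivity)
  have hx := Real.exp_pos (-T)
  have h1 := mul_nonneg hT (hH0 _ hx.le)
  have h2 : 1 / m + Real.exp (-T) ≤ Real.exp (m * Real.exp (-T)) / m := by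
    rw [le_div_iff₀ hm]
    have : (1 / m + Real.exp (-T)) * m = m * Real.exp (-T) + 1 := by field_simp; ring
    rw [this]
    exact Real.add_one_le_exp _
  have h3 : (1 - μ + m) * Real.exp (-T) ≤ Real.exp (-T) :=
    mul_le_of_le_one_left hx.le (by linarith)
  rw [sub_div]
  linarith

/-- By the fixed point equation the first product equals `1`; the subtracted one is positive because
`ν > μ - 1`. -/
theorem contraction_nu_lt_one {μ : ℝ} (hμ : 1 < μ) : contraction μ (nu μ) < 1 := by
  obtain ⟨h1, -, h3⟩ := nu_spec hμ
  have hν := nu_pos hμ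
  have h4 : μ * Real.exp (-nu μ) * ((Real.exp (nu μ) - 1) / nu μ) = 1 := by
    have h5 : Real.exp (-nu μ) * (Real.exp (nu μ) - 1) = 1 - Real.exp (-nu μ) := by
      rw [mul_sub, ← Real.exp_add]; simp
    rw [mul_assoc, mul_div_assoc', h5, mul_div_assoc', ← h3, div_self hν.ne']
  rw [contraction, mul_sub, h4]
  have : 0 < μ * Real.exp (-nu μ) * (1 - μ + nu μ) := by
    have : 0 < 1 - μ + nu μ := by linarith
    positivity
  linarith

/-- Room below `ν` is needed, since the activity is only known to exceed eventually each number
below `ν`. -/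
theorem exists_contraction_lt_one {μ : ℝ} (hμ : 1 < μ) :
    ∃ m, μ - 1 < m ∧ m < nu μ ∧ contraction μ m < 1 := by
  have hν := nu_pos hμ
  have hc : ContinuousAt (contraction μ) (nu μ) := by
    have := hν.ne'
    unfold contraction
    fun_prop (disch := assumption)
  have h1 := (hc.eventually (gt_mem_nhds (contraction_nu_lt_one hμ))).filter_mono
    (nhdsWithin_le_nhds (s := Iio (nu μ)))
  have h2 : ∀ᶠ m in 𝓝[<] (nu μ), μ - 1 < m :=
    (lt_mem_nhds (nu_spec hμ).1).filter_mono nhdsWithin_le_nhds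
  obtain ⟨m, hm1, hm2, hm3⟩ := (h1.and (h2.and self_mem_nhdsWithin)).exists
  exact ⟨m, hm2, hm3, hm1⟩

/-! ### Eventual lower bounds for the activity. -/

namespace TailFlow

variable {μ : ℝ} {a : ℝ → ℝ} {h : ℕ → ℝ → ℝ} (hf : TailFlow μ a h)
include hf

theorem shift {τ : ℝ} (hτ : 0 ≤ τ) :
    TailFlow μ (fun t => a (t + τ)) (fun k t => h k (t + τ)) := by
  have hd : ∀ {f : ℝ → ℝ} {f' t : ℝ}, HasDerivWithinAt f f' (Ici 0) (t + τ) →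
      HasDerivWithinAt (fun s => f (s + τ)) f' (Ici 0) t := fun {f f' t} hff => by
    have h1 := ((hasDerivAt_id t).add_const τ).hasDerivWithinAt (s := Ici 0)
    have := HasDerivWithinAt.comp t (h := fun s => s + τ) (h₂ := f) hff h1
      fun s hs => add_nonneg (mem_Ici.1 hs) hτ
    exact this.congr_deriv (mul_one _)
  have hc := hf.continuous
  exact ⟨by fun_prop, fun t ht => hd (hf.deriv_zero _ (add_nonneg ht hτ)),
    fun k t ht => hd (hf.deriv_succ k _ (add_nonneg ht hτ)),
    fun t ht => hf.antitone _ (add_nonneg ht hτ), fun k t ht => hf.nonneg k _ (add_nonneg ht hτ),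
    fun t ht => hf.le_one _ (add_nonneg ht hτ), fun t ht => hf.hasSum _ (add_nonneg ht hτ),
    fun t ht => hf.active_eq _ (add_nonneg ht hτ)⟩

/-- `(1 - h 0) * exp A` decreases. With a general `A`, an integrable deficit in the lower bound for
`a` costs only a constant factor. -/
theorem empty_le_exp {A A' : ℝ → ℝ} (hA : ∀ s, HasDerivAt A (A' s) s)
    (hA' : ∀ s, 0 ≤ s → A' s ≤ a s) {T : ℝ} (hT : 0 ≤ T) :
    1 - h 0 T ≤ Real.exp (A 0 - A T) := by
  have hAc : Continuous A := continuous_iff_continuousAt.2 fun s => (hA s).continuousAt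
  have hd := fun s (hs : 0 ≤ s) => (hf.deriv_empty hs).mul (hA s).exp.hasDerivWithinAt
  have := sub_le_sub_of_deriv_right_le hT
    (fun s hs => (hd s hs.1).continuousWithinAt.mono Icc_subset_Ici_self)
    (fun s hs => (hd s hs.1).mono (Ici_subset_Ici.2 hs.1)) (g := fun _ => 0) (g' := fun _ => 0)
    continuousOn_const (fun s _ => hasDerivWithinAt_const _ _ _) (fun s hs => by
      have h1 := mul_nonneg (mul_nonneg (sub_nonneg.2 (hf.le_one s hs.1)) (Real.exp_pos (A s)).le)
        (sub_nonneg.2 (hA' s hs.1))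
      linarith)
  simp only [Pi.mul_apply, sub_self] at this
  have h0 := hf.nonneg 0 0 le_rfl
  have h1 := (Real.exp_pos (A 0)).le
  rw [Real.exp_sub, le_div_iff₀ (Real.exp_pos _)]
  nlinarith

theorem empty_le_exp_of_le {c : ℝ} (hc : ∀ s, 0 ≤ s → c ≤ a s) {T : ℝ} (hT : 0 ≤ T) :
    1 - h 0 T ≤ Real.exp (-c * T) := by
  have := hf.empty_le_exp (A := fun s => c * s) (A' := fun _ => c)
    (fun s => by simpa using (hasDerivAt_id s).const_mul c) hc hT
  simpa using this

theorem le_discounted {m : ℝ} (ha : ∀ s, 0 ≤ s → m ≤ a s) {s T : ℝ} (hs : 0 ≤ s) (hsT : s ≤ T) :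
    m * (1 - Real.exp (s - T)) ≤ discounted a T s := by
  have := discounted_mono continuous_const hf.continuous hs hsT ha
  rwa [discounted_const] at this

theorem integrable_gain (T : ℝ) : IntervalIntegrable
    (fun s => μ * (Real.exp (s - T) * gain (μ - 1) (discounted a T s))) volume 0 T := by
  have := continuous_discounted hf.continuous T
  exact Continuous.intervalIntegrable (by simp only [gain]; fun_prop) _ _

/-- A lower bound for the activity at time `T` if it is at least `m` at all times. -/
theorem active_ge {m : ℝ} (hm : 0 < m) (ha : ∀ s, 0 ≤ s → m ≤ a s) {T : ℝ} (hT : 0 ≤ T) :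
    2 * μ - 2 + μ / m * ((2 - μ)
        - (m * (1 - Real.exp (-T)) + 2 - μ) * Real.exp (-(m * (1 - Real.exp (-T)))))
      - |μ - 2| * Real.exp (-m * T) - μ * (1 + μ + |μ - 1|) * Real.exp (-T) ≤ a T := by
  have hμ := hf.mean_nonneg
  have h1 := (abs_le.1 (hf.abs_sub_integral_gain_le (μ - 1) hT)).1
  have h2 : ∫ s in (0 : ℝ)..T, μ * (Real.exp (s - T) * gain (μ - 1) (m * (1 - Real.exp (s - T))))
      ≤ ∫ s in (0 : ℝ)..T, μ * (Real.exp (s - T) * gain (μ - 1) (discounted a T s)) := by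
    refine intervalIntegral.integral_mono_on hT
      (Continuous.intervalIntegrable (by simp only [gain]; fun_prop) _ _)
      (hf.integrable_gain T) fun s hs => ?_
    have h3 := hf.le_discounted ha hs.1 hs.2
    have h4 := hf.discounted_le hs.1 hs.2
    refine mul_le_mul_of_nonneg_left (mul_le_mul_of_nonneg_left ?_ (Real.exp_pos _).le) hμ
    exact gain_monotoneOn μ (mem_Iic.2 (h3.trans h4)) (mem_Iic.2 h4) h3
  rw [integral_gain_const hm] at h2
  have h3 := hf.empty_le_exp_of_le ha hT
  have h4 : (μ - 2) * (1 - h 0 T) ≤ |μ - 2| * Real.exp (-m * T) :=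
    mul_le_mul (le_abs_self _) h3 (sub_nonneg.2 (hf.le_one T hT)) (abs_nonneg _)
  -- Read as `a = 2 μ - 2 + (h 1 - (μ - 1) * h 0) - (μ - 2) * (1 - h 0)`.
  have h5 := hf.active_eq T hT
  nlinarith

end TailFlow

theorem limit_active_gt {μ m : ℝ} (hμ : 1 < μ) (hm : μ - 1 ≤ m) (hmν : m < nu μ) :
    m < 2 * μ - 2 + μ / m * ((2 - μ) - (m + 2 - μ) * Real.exp (-m)) := by
  have hm0 : 0 < m := by linarith
  obtain ⟨-, -, h3⟩ := nu_spec hμ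
  have hν := nu_pos hμ
  have h1 := one_sub_exp_neg_div_lt hm0 hmν
  have h2 : m < μ * (1 - Real.exp (-m)) := by
    have h4 := mul_lt_mul_of_pos_left h1 (by linarith : 0 < μ)
    have h5 : μ * (m * (1 - Real.exp (-nu μ))) = m * nu μ := by
      rw [mul_left_comm, ← h3]
    rw [h5] at h4
    nlinarith
  have h6 : m * (2 * μ - 2 + μ / m * ((2 - μ) - (m + 2 - μ) * Real.exp (-m)))
      = m * m + (μ * (1 - Real.exp (-m)) - m) * (2 + m - μ) := by
    field_simp
    ring
  have h7 : 0 < (μ * (1 - Real.exp (-m)) - m) * (2 + m - μ) :=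
    mul_pos (by linarith) (by linarith)
  exact lt_of_mul_lt_mul_left (by linarith) hm0.le

theorem tendsto_exp_neg_mul {c : ℝ} (hc : 0 < c) :
    Tendsto (fun T : ℝ => Real.exp (-c * T)) atTop (𝓝 0) := by
  have := Real.tendsto_exp_neg_atTop_nhds_zero.comp (tendsto_id.const_mul_atTop hc)
  simpa [Function.comp_def] using this

/-- The activity is eventually larger than any number below `ν`, uniformly in the solution. -/
theorem eventually_le_active {μ m : ℝ} (hμ : 1 < μ) (hm : m < nu μ) :
    ∃ T₀, 0 ≤ T₀ ∧ ∀ a h, TailFlow μ a h → ∀ t, T₀ ≤ t → m ≤ a t := by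
  set good : ℝ → Prop := fun m =>
    ∃ T₀, 0 ≤ T₀ ∧ ∀ a h, TailFlow μ a h → ∀ t, T₀ ≤ t → m ≤ a t with hgood
  set G : ℝ → ℝ := fun m => 2 * μ - 2 + μ / m * ((2 - μ) - (m + 2 - μ) * Real.exp (-m)) with hG
  have hdown : ∀ m m', m' ≤ m → good m → good m' := fun m m' hle ⟨T₀, h0, hT⟩ =>
    ⟨T₀, h0, fun a h hf t ht => hle.trans (hT a h hf t ht)⟩
  have hstep : ∀ m m', 0 < m → good m → m' < G m → good m' := by
    rintro m m' hm0 ⟨T₀, hT₀, hT⟩ hlt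
    have he : Tendsto (fun T : ℝ => Real.exp (-T)) atTop (𝓝 0) :=
      Real.tendsto_exp_neg_atTop_nhds_zero
    have hu : Tendsto (fun T : ℝ => m * (1 - Real.exp (-T))) atTop (𝓝 m) := by
      simpa using (he.const_sub 1).const_mul m
    have hlim : Tendsto (fun T : ℝ => 2 * μ - 2 + μ / m * ((2 - μ)
        - (m * (1 - Real.exp (-T)) + 2 - μ) * Real.exp (-(m * (1 - Real.exp (-T)))))
      - |μ - 2| * Real.exp (-m * T) - μ * (1 + μ + |μ - 1|) * Real.exp (-T)) atTop (𝓝 (G m)) := by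
      have h1 := (((hu.add_const 2).sub_const μ).mul
        ((Real.continuous_exp.tendsto _).comp hu.neg)).const_sub (2 - μ)
      have h2 := (((h1.const_mul (μ / m)).const_add (2 * μ - 2)).sub
        ((tendsto_exp_neg_mul hm0).const_mul |μ - 2|)).sub (he.const_mul (μ * (1 + μ + |μ - 1|)))
      simpa [hG, Function.comp_def] using h2
    obtain ⟨T₁, hT₁⟩ := eventually_atTop.1 (hlim.eventually (lt_mem_nhds hlt))
    refine ⟨T₀ + max T₁ 0, by positivity, fun a h hf t ht => ?_⟩
    have h1 := (le_max_left T₁ 0)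
    have h2 := (le_max_right T₁ 0)
    have h3 := (hf.shift hT₀).active_ge hm0 (fun s hs => hT a h hf _ (by linarith))
      (T := t - T₀) (by linarith)
    have h4 := hT₁ (t - T₀) (by linarith)
    rw [sub_add_cancel] at h3
    linarith
  have hbase : good (μ - 1) := ⟨0, le_rfl, fun a h hf t ht => hf.le_active ht⟩
  -- Let `M` be the supremum of the eventual lower bounds. If `M < ν`, then `G > M` near `M`, and
  -- one step from a good `m₁` close to `M` produces a good bound above `M`.
  by_contra hbad
  have hub : ∀ m', good m' → m' ≤ m := fun m' hm' => by
    by_contra hlt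
    exact hbad (hdown m' m (not_le.1 hlt).le hm')
  set M := sSup {m | good m} with hM
  have hbdd : BddAbove {m | good m} := ⟨m, hub⟩
  have hM1 : μ - 1 ≤ M := le_csSup hbdd hbase
  have hM2 : M < nu μ := (csSup_le (s := {m | good m}) ⟨_, hbase⟩ hub).trans_lt hm
  have hMpos : M ≠ 0 := by linarith
  have hGc : ContinuousAt G M := by
    simp only [hG]
    fun_prop (disch := assumption)
  obtain ⟨ε, hε, hball⟩ := Metric.eventually_nhds_iff.1
    (hGc.eventually (lt_mem_nhds (limit_active_gt hμ hM1 hM2)))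
  obtain ⟨m₁, hm₁, hlt⟩ := exists_lt_of_lt_csSup (⟨_, hbase⟩ : {m | good m}.Nonempty)
    (show max (M - ε) ((μ - 1) / 2) < M from max_lt (by linarith) (by linarith))
  have hm₁M : m₁ ≤ M := le_csSup hbdd hm₁
  have h1 : M < G m₁ := hball (by
    rw [Real.dist_eq, abs_lt]
    constructor <;> linarith [le_max_left (M - ε) ((μ - 1) / 2)])
  obtain ⟨m₂, hm₂, hm₂'⟩ := exists_between h1
  have h2 := hstep m₁ m₂ (by linarith [le_max_right (M - ε) ((μ - 1) / 2)]) hm₁ hm₂'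
  exact absurd (le_csSup hbdd h2) (not_le.2 hm₂)

/-! ### Exponential convergence of the activity. -/

namespace TailFlow

variable {μ : ℝ} {a : ℝ → ℝ} {h : ℕ → ℝ → ℝ} (hf : TailFlow μ a h)
include hf

/-- The activity is the value of a contraction up to exponentially small errors. -/
theorem abs_active_sub_nu_le (hμ : 1 < μ) {m : ℝ} (hm : 0 < m) (hm1 : μ - 1 ≤ m) (hmν : m ≤ nu μ)
    (ha : ∀ s, 0 ≤ s → m ≤ a s) {θ D T : ℝ} (hθ : θ ≤ 1) (hT : 0 ≤ T)
    (hD : ∀ s ∈ Icc 0 T, |a s - nu μ| ≤ D * Real.exp (-θ * s)) :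
    |a T - nu μ| ≤ 2 * (μ * (1 + μ + |μ - 1|)) * Real.exp (-T) + |μ - 2| * (1 - h 0 T)
      + contraction μ m * (D * Real.exp (-θ * T)) := by
  obtain ⟨-, hνμ, -⟩ := nu_spec hμ
  have hμ0 := hf.mean_nonneg
  have hs := tailFlow_truncatedPoisson hμ
  have h1 := abs_le.1 (hf.abs_sub_integral_gain_le (μ - 1) hT)
  have h2 := abs_le.1 (hs.abs_sub_integral_gain_le (μ - 1) hT)
  have hD0 : 0 ≤ D * Real.exp (-θ * T) := (abs_nonneg _).trans (hD T ⟨hT, le_rfl⟩)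
  have h3 : |(∫ s in (0 : ℝ)..T, μ * (Real.exp (s - T) * gain (μ - 1) (discounted a T s)))
      - ∫ s in (0 : ℝ)..T, μ * (Real.exp (s - T) * gain (μ - 1) (discounted (fun _ => nu μ) T s))|
      ≤ contraction μ m * (D * Real.exp (-θ * T)) := by
    rw [← intervalIntegral.integral_sub (hf.integrable_gain T) (hs.integrable_gain T)]
    refine le_trans ?_ (mul_le_mul_of_nonneg_right
      (integral_slope_le hm hm1 (hmν.trans hνμ.le) hT) hD0)
    rw [← intervalIntegral.integral_mul_const, ← Real.norm_eq_abs]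
    refine intervalIntegral.norm_integral_le_of_norm_le hT ?_
      (Continuous.intervalIntegrable (by fun_prop) _ _)
    refine Eventually.of_forall fun s hs' => ?_
    have hs0 := hs'.1.le
    rw [← mul_sub, ← mul_sub, Real.norm_eq_abs, abs_mul, abs_mul, Real.abs_exp, abs_of_nonneg hμ0]
    have h4 := abs_gain_sub_le (μ := μ)
      ⟨hf.le_discounted ha hs0 hs'.2, hf.discounted_le hs0 hs'.2⟩
      ⟨hs.le_discounted (fun _ _ => hmν) hs0 hs'.2, hs.discounted_le hs0 hs'.2⟩
    have h5 := abs_discounted_sub_le hf.continuous (continuous_const (y := nu μ)) hs'.2 hθ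
      fun t ht => hD t ⟨hs0.trans ht.1, ht.2⟩
    have h6 : 0 ≤ μ - m * (1 - Real.exp (s - T)) := by
      have h7 := hf.le_discounted ha hs0 hs'.2
      have h8 := hf.discounted_le hs0 hs'.2
      linarith
    have h9 := mul_le_mul_of_nonneg_left h5
      (mul_nonneg h6 (Real.exp_pos (-(m * (1 - Real.exp (s - T))))).le)
    exact (mul_le_mul_of_nonneg_left (mul_le_mul_of_nonneg_left (h4.trans h9)
      (Real.exp_pos _).le) hμ0).trans_eq (by ring)
  have h3' := abs_le.1 h3
  have h4 := hf.active_eq T hT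
  have h5 := hs.active_eq T hT
  have h6 : tail (truncatedPoisson (nu μ)) 0 = 1 := by simp [tail_zero, truncatedPoisson]
  have h7 : |(μ - 2) * (1 - h 0 T)| = |μ - 2| * (1 - h 0 T) := by
    rw [abs_mul, abs_of_nonneg (sub_nonneg.2 (hf.le_one T hT))]
  have h8 := abs_le.1 h7.le
  rw [h6] at h5
  simp only [h6] at h2
  rw [abs_le]
  constructor <;> linarith [h1.1, h1.2, h2.1, h2.2, h3'.1, h3'.2, h8.1, h8.2]

theorem abs_active_sub_nu_le_exp (hμ : 1 < μ) {m : ℝ} (hm : 0 < m) (hm1 : μ - 1 ≤ m)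
    (hmν : m ≤ nu μ) (hκ : contraction μ m < 1) (ha : ∀ s, 0 ≤ s → m ≤ a s) {θ P : ℝ}
    (hθ : θ ≤ 1) (hP : ∀ s, 0 ≤ s → 1 - h 0 s ≤ P * Real.exp (-θ * s)) {T : ℝ} (hT : 0 ≤ T) :
    |a T - nu μ| ≤ (2 * (μ * (1 + μ + |μ - 1|)) + |μ - 2| * P) / (1 - contraction μ m)
      * Real.exp (-θ * T) := by
  have hμ0 := hf.mean_nonneg
  have hc := hf.continuous
  -- At the maximiser `τ` of the weighted error, the estimate bounds `D` by a constant plus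
  -- `contraction μ m * D`, and `D` is finite.
  obtain ⟨τ, hτ, hmax⟩ := (isCompact_Icc (a := (0 : ℝ)) (b := T)).exists_isMaxOn
    ⟨0, le_rfl, hT⟩ (f := fun s => |a s - nu μ| * Real.exp (θ * s)) (by fun_prop)
  set D := |a τ - nu μ| * Real.exp (θ * τ) with hD
  have hle : ∀ s ∈ Icc 0 T, |a s - nu μ| ≤ D * Real.exp (-θ * s) := fun s hs => by
    have : |a s - nu μ| * Real.exp (θ * s) ≤ D := hmax hs
    rw [neg_mul, Real.exp_neg, ← div_eq_mul_inv, le_div_iff₀ (Real.exp_pos _)]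
    exact this
  have key := hf.abs_active_sub_nu_le hμ hm hm1 hmν ha hθ hτ.1
    (fun s hs => hle s ⟨hs.1, hs.2.trans hτ.2⟩)
  have h1 : Real.exp (-τ) ≤ Real.exp (-θ * τ) := Real.exp_le_exp.2 (by nlinarith [hτ.1])
  have h2 : |μ - 2| * (1 - h 0 τ) ≤ |μ - 2| * (P * Real.exp (-θ * τ)) :=
    mul_le_mul_of_nonneg_left (hP τ hτ.1) (abs_nonneg _)
  have h3 : |a τ - nu μ|
      ≤ (2 * (μ * (1 + μ + |μ - 1|)) + |μ - 2| * P + contraction μ m * D) * Real.exp (-θ * τ) := by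
    have h4 := mul_le_mul_of_nonneg_left h1
      (by positivity : 0 ≤ 2 * (μ * (1 + μ + |μ - 1|)))
    linarith
  have h5 : D ≤ 2 * (μ * (1 + μ + |μ - 1|)) + |μ - 2| * P + contraction μ m * D := by
    have := mul_le_mul_of_nonneg_right h3 (Real.exp_pos (θ * τ)).le
    rw [mul_assoc, ← Real.exp_add] at this
    simpa using this
  have h6 : D ≤ (2 * (μ * (1 + μ + |μ - 1|)) + |μ - 2| * P) / (1 - contraction μ m) := by
    rw [le_div_iff₀ (by linarith)]; linarith
  exact (hle T ⟨hT, le_rfl⟩).trans (mul_le_mul_of_nonneg_right h6 (Real.exp_pos _).le)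

end TailFlow

/-- The activity converges to `ν` at the optimal rate, uniformly in the solution. -/
theorem exists_abs_active_sub_nu_le {μ : ℝ} (hμ : 1 < μ) :
    ∃ D, 0 ≤ D ∧ ∀ a h, TailFlow μ a h → ∀ t, 0 ≤ t →
      |a t - nu μ| ≤ D * Real.exp (-min (nu μ) 1 * t) := by
  obtain ⟨m, hm1, hmν, hκ⟩ := exists_contraction_lt_one hμ
  have hm0 : 0 < m := by linarith
  have hν := nu_pos hμ
  have hνμ := (nu_spec hμ).2.1
  obtain ⟨T₀, hT₀, hentry⟩ := eventually_le_active hμ hmν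
  set θ₁ := min m 1
  have hθ₁ : 0 < θ₁ := lt_min hm0 one_pos
  set θ := min (nu μ) 1
  set D₁ := (2 * (μ * (1 + μ + |μ - 1|)) + |μ - 2| * 1) / (1 - contraction μ m)
  set P := Real.exp (D₁ / θ₁)
  set D₂ := (2 * (μ * (1 + μ + |μ - 1|)) + |μ - 2| * P) / (1 - contraction μ m)
  have hκ' : 0 < 1 - contraction μ m := by linarith
  have hD₁ : 0 ≤ D₁ := by positivity
  have hD₂ : 0 ≤ D₂ := by positivity
  have hshift : ∀ a h, TailFlow μ a h → ∀ t, 0 ≤ t →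
      |a (t + T₀) - nu μ| ≤ D₂ * Real.exp (-θ * t) := by
    intro a h hf
    have hs := hf.shift hT₀
    have ha : ∀ s, 0 ≤ s → m ≤ a (s + T₀) := fun s hs => hentry a h hf _ (by linarith)
    -- First pass: `a ≥ m` only gives empty sites decaying at rate `m`, hence the rate `θ₁`.
    have h1 : ∀ t, 0 ≤ t → |a (t + T₀) - nu μ| ≤ D₁ * Real.exp (-θ₁ * t) := fun t ht => by
      refine hs.abs_active_sub_nu_le_exp hμ hm0 hm1.le hmν.le hκ ha (min_le_right _ _)
        (fun s hs0 => ?_) ht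
      rw [one_mul]
      refine (hs.empty_le_exp_of_le ha hs0).trans (Real.exp_le_exp.2 ?_)
      exact mul_le_mul_of_nonneg_right (neg_le_neg (min_le_left _ _)) hs0
    refine fun t ht => hs.abs_active_sub_nu_le_exp hμ hm0 hm1.le hmν.le hκ ha (min_le_right _ _)
        (fun s hs0 => ?_) ht
    -- Second pass: the deficit of `a` below `ν` has integral at most `D₁ / θ₁`, so empty sites
    -- decay at the full rate `ν` with factor `P`.
    have hA : ∀ s, HasDerivAt (fun s => nu μ * s + D₁ / θ₁ * Real.exp (-θ₁ * s))
        (nu μ - D₁ * Real.exp (-θ₁ * s)) s := fun s => by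
      have h2 : HasDerivAt (fun s => Real.exp (-θ₁ * s)) (Real.exp (-θ₁ * s) * -θ₁) s := by
        simpa using ((hasDerivAt_id s).const_mul (-θ₁)).exp
      refine ((by simpa using (hasDerivAt_id s).const_mul (nu μ) :
        HasDerivAt (fun s => nu μ * s) (nu μ) s).add (h2.const_mul (D₁ / θ₁))).congr_deriv ?_
      field_simp
      ring
    refine (hs.empty_le_exp hA (fun s hs0 => by linarith [(abs_le.1 (h1 s hs0)).1]) hs0).trans ?_
    rw [← Real.exp_add]
    refine Real.exp_le_exp.2 ?_
    have h3 : θ * s ≤ nu μ * s := mul_le_mul_of_nonneg_right (min_le_left _ _) hs0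
    have h4 : 0 ≤ D₁ / θ₁ * Real.exp (-θ₁ * s) := by positivity
    simp only [mul_zero, Real.exp_zero, mul_one, zero_add]
    linarith
  -- The exponential undoes the time shift; `μ` covers `t ≤ T₀`, where `|a - ν| ≤ μ`.
  refine ⟨(D₂ + μ) * Real.exp (θ * T₀), by positivity, fun a h hf t ht => ?_⟩
  rw [mul_assoc, ← Real.exp_add]
  rcases le_total T₀ t with hle | hle
  · have h1 := hshift a h hf (t - T₀) (by linarith)
    rw [sub_add_cancel] at h1
    refine h1.trans ?_
    rw [show θ * T₀ + -θ * t = -θ * (t - T₀) by ring]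
    gcongr
    linarith
  · have h1 : |a t - nu μ| ≤ μ := by
      have h2 := hf.active_nonneg ht
      have h3 := hf.active_le ht
      rw [abs_le]; constructor <;> linarith
    have h2 : 1 ≤ Real.exp (θ * T₀ + -θ * t) := by
      refine Real.one_le_exp ?_
      have : 0 < θ := lt_min hν one_pos
      nlinarith
    nlinarith

/-! ### From the activity to the `ℓ¹` distance. -/

/-- Contraction of the `ℓ¹` distance of the tails to the stationary tails. -/
theorem TailFlow.tsum_abs_sub_le {μ : ℝ} {a : ℝ → ℝ} {h : ℕ → ℝ → ℝ} (hf : TailFlow μ a h)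
    (hμ : 1 < μ) {g g' : ℝ → ℝ} (hg : ∀ s, HasDerivAt g (g' s) s)
    (hle : ∀ s, 0 ≤ s → 2 * Real.exp s * |a s - nu μ| ≤ g' s) {T : ℝ} (hT : 0 ≤ T) :
    Real.exp T * ∑' k, |h k T - tail (truncatedPoisson (nu μ)) k| ≤ 2 * μ + (g T - g 0) := by
  have hμ0 := hf.mean_nonneg
  set q := tail (truncatedPoisson (nu μ)) with hq
  have hs := tailFlow_truncatedPoisson hμ
  have hq0 : q 0 = 1 := by simp [hq, tail_zero, truncatedPoisson]
  have hqn : ∀ k, 0 ≤ q k := fun k => hs.nonneg k 0 le_rfl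
  have hqa : Antitone q := hs.antitone 0 le_rfl
  set e : ℕ → ℝ → ℝ := fun k t => h k t - q k with he
  have habs : ∀ k t, 0 ≤ t → |e k t| ≤ h k t + q k := fun k t ht => by
    have h1 := hf.nonneg k t ht
    have h2 := hqn k
    simp only [he]
    rw [abs_le]; constructor <;> linarith
  have hsm : ∀ t, 0 ≤ t → Summable fun k => |e k t| := fun t ht =>
    Summable.of_nonneg_of_le (fun k => abs_nonneg _) (fun k => habs k t ht)
      ((hf.hasSum t ht).add (hs.hasSum 0 le_rfl)).summable
  have h0d : ∀ s, 0 ≤ s → ∃ d, HasDerivWithinAt (fun t => |e 0 t|) d (Ici s) s ∧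
      d ≤ -(1 + a s) * |e 0 s| + (|e 1 s| + |a s - nu μ|) := fun s hs0 => by
    have h1 : HasDerivWithinAt (e 0) (-(1 + a s) * e 0 s + (e 1 s - (a s - nu μ))) (Ici s) s := by
      refine (((hf.deriv_zero s hs0).mono (Ici_subset_Ici.2 hs0)).sub_const (q 0)).congr_deriv ?_
      have h2 := hs.active_eq 0 le_rfl
      simp only [← hq] at h2
      simp only [he, hq0] at h2 ⊢
      linarith
    obtain ⟨d, hd, hd'⟩ := exists_deriv_right_abs_le h1
    exact ⟨d, hd, hd'.trans (add_le_add le_rfl (abs_sub _ _))⟩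
  have hkd : ∀ (k : ℕ) (s : ℝ), 0 ≤ s → ∃ d, HasDerivWithinAt (fun t => |e (k + 1) t|) d (Ici s) s ∧
      d ≤ -((k : ℝ) + 2 + a s) * |e (k + 1) s| + (((k : ℝ) + 2) * |e (k + 2) s| + a s * |e k s|
        + |a s - nu μ| * (q k - q (k + 1))) := fun k s hs0 => by
    have h1 : HasDerivWithinAt (e (k + 1)) (-((k : ℝ) + 2 + a s) * e (k + 1) s
        + (((k : ℝ) + 2) * e (k + 2) s + a s * e k s + (a s - nu μ) * (q k - q (k + 1))))
        (Ici s) s := by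
      refine (((hf.deriv_succ k s hs0).mono (Ici_subset_Ici.2 hs0)).sub_const (q (k + 1))).congr_deriv ?_
      have h3 := truncatedPoisson_balance (ν := nu μ) k
      have h4 : q (k + 2) = q (k + 1) - truncatedPoisson (nu μ) (k + 2) := tail_succ _ (k + 1)
      have h5 : q (k + 1) = q k - truncatedPoisson (nu μ) (k + 1) := tail_succ _ k
      simp only [he]
      linear_combination ((k : ℝ) + 2) * h4 - nu μ * h5 - h3
    obtain ⟨d, hd, hd'⟩ := exists_deriv_right_abs_le h1
    refine ⟨d, hd, hd'.trans (add_le_add le_rfl ?_)⟩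
    refine (abs_add_le _ _).trans (add_le_add ((abs_add_le _ _).trans (add_le_add ?_ ?_)) ?_)
    · rw [abs_mul, abs_of_nonneg (by positivity)]
    · rw [abs_mul, abs_of_nonneg (hf.active_nonneg hs0)]
    · rw [abs_mul, abs_of_nonneg (sub_nonneg.2 (hqa k.le_succ))]
  choose! d₀ hd₀ hd₀' using h0d
  choose! d hd hd' using hkd
  let dd : ℕ → ℝ → ℝ := fun k s => Nat.casesOn k (d₀ s) fun k => d k s
  have hddd : ∀ k s, 0 ≤ s → HasDerivWithinAt (fun t => |e k t|) (dd k s) (Ici s) s := fun k s hs0 => by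
    cases k with
    | zero => exact hd₀ s hs0
    | succ k => exact hd k s hs0
  -- `|e k|` enters with `k` from row `k - 1`, `a` from row `k + 1` and `-(k + 1 + a)` from its own
  -- row, in total `-1`. The sources telescope to `1 + (q 0 - q N)`.
  have hsum : ∀ (N : ℕ) (s : ℝ), 0 ≤ s → ∑ k ∈ Finset.range (N + 1), dd k s
      ≤ -∑ k ∈ Finset.range (N + 1), |e k s| + ((N : ℝ) + 1) * |e (N + 1) s| - a s * |e N s|
        + |a s - nu μ| * (2 - q N) := fun N s hs0 => by
    induction N with
    | zero =>
      have : dd 0 s ≤ _ := hd₀' s hs0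
      simp only [zero_add, Finset.sum_range_one, hq0]
      push_cast
      linarith
    | succ N ih =>
      have : dd (N + 1) s ≤ _ := hd' N s hs0
      rw [Finset.sum_range_succ _ (N + 1), Finset.sum_range_succ _ (N + 1)]
      push_cast
      linarith
  have hec : ∀ k, ContinuousOn (fun t => |e k t|) (Icc 0 T) := fun k =>
    (((hf.continuousOn k).sub continuousOn_const).mono Icc_subset_Ici_self).abs
  have hgc : Continuous g := continuous_iff_continuousAt.2 fun s => (hg s).continuousAt
  have hlim : ∀ t, 0 ≤ t → Tendsto (fun N => Real.exp t * ∑ k ∈ Finset.range (N + 1), |e k t|) atTop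
      (𝓝 (Real.exp t * ∑' k, |e k t|)) := fun t ht =>
    ((hsm t ht).hasSum.tendsto_sum_nat.comp (tendsto_add_atTop_nat 1)).const_mul _
  have hbd : ∀ (N : ℕ) (s : ℝ), 0 ≤ s → ((N : ℝ) + 1) * |e (N + 1) s|
      ≤ ((N + 1 : ℕ) : ℝ) * h (N + 1) s + ((N + 1 : ℕ) : ℝ) * q (N + 1) := fun N s hs0 => by
    have := mul_le_mul_of_nonneg_left (habs (N + 1) s hs0) (by positivity : (0 : ℝ) ≤ (N : ℝ) + 1)
    push_cast; linarith
  have key := sub_le_sub_of_tendsto_deriv_right_le hT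
    (F := fun N t => Real.exp t * ∑ k ∈ Finset.range (N + 1), |e k t|)
    (F' := fun N s => Real.exp s * ∑ k ∈ Finset.range (N + 1), |e k s|
      + Real.exp s * ∑ k ∈ Finset.range (N + 1), dd k s)
    (E := fun N s => Real.exp s * (((N : ℝ) + 1) * |e (N + 1) s|))
    (B := Real.exp T * (2 * μ))
    (fun N => Real.continuous_exp.continuousOn.mul (continuousOn_finsetSum _ fun k _ => hec k))
    (fun N s hs0 => (Real.hasDerivAt_exp s).hasDerivWithinAt.mul
      (HasDerivWithinAt.fun_sum fun k _ => hddd k s hs0.1))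
    hgc.continuousOn (fun s _ => (hg s).hasDerivWithinAt)
    (fun N => Real.continuous_exp.continuousOn.mul (continuousOn_const.mul (hec _)))
    (fun N s hs0 => by
      rw [abs_of_nonneg (by positivity)]
      have h1 := hbd N s hs0.1
      have h2 := hf.mul_le hs0.1 (N + 1)
      have h3 := hs.mul_le (t := 0) le_rfl (N + 1)
      refine mul_le_mul (Real.exp_le_exp.2 hs0.2) ?_ (by positivity) (by positivity)
      simp only [← hq] at h3
      linarith)
    (fun s hs0 => by
      have h1 : Tendsto (fun N : ℕ => ((N : ℝ) + 1) * |e (N + 1) s|) atTop (𝓝 0) := by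
        refine squeeze_zero (fun N => by positivity) (fun N => hbd N s hs0.1) ?_
        simpa [Function.comp_def, ← hq] using ((hf.tendsto_mul hs0.1).add (hs.tendsto_mul (t := 0) le_rfl)).comp
          (tendsto_add_atTop_nat 1)
      simpa using h1.const_mul (Real.exp s))
    (fun N s hs0 => by
      have h1 := hsum N s hs0.1
      have h2 := hle s hs0.1
      have h3 : |a s - nu μ| * (2 - q N) ≤ |a s - nu μ| * 2 :=
        mul_le_mul_of_nonneg_left (by linarith [hqn N]) (abs_nonneg _)
      have h4 := mul_nonneg (hf.active_nonneg hs0.1) (abs_nonneg (e N s))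
      have h5 : ∑ k ∈ Finset.range (N + 1), |e k s| + ∑ k ∈ Finset.range (N + 1), dd k s
          ≤ ((N : ℝ) + 1) * |e (N + 1) s| + |a s - nu μ| * 2 := by linarith
      have h6 := mul_le_mul_of_nonneg_left h5 (Real.exp_pos s).le
      linarith)
    (hlim 0 le_rfl) (hlim T hT)
  have h0 : ∑' k, |e k 0| ≤ 2 * μ := by
    refine hasSum_le (fun k => habs k 0 le_rfl) (hsm 0 le_rfl).hasSum ?_
    rw [two_mul]
    exact (hf.hasSum 0 le_rfl).add (hs.hasSum 0 le_rfl)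
  rw [Real.exp_zero, one_mul] at key
  linarith

theorem ell1Dist_le_two_mul_tsum {q r : ℕ → ℝ} (hs : Summable fun k => |tail q k - tail r k|) :
    ell1Dist q r ≤ 2 * ∑' k, |tail q k - tail r k| := by
  have hpart : ∀ N, ∑ k ∈ Finset.range N, |tail q k - tail r k| ≤ ∑' k, |tail q k - tail r k| :=
    fun N => hs.sum_le_tsum _ fun k _ => abs_nonneg _
  have hind : ∀ N, ∑ n ∈ Finset.range (N + 1), |q n - r n|
      ≤ ∑ k ∈ Finset.range (N + 1), |tail q k - tail r k|
        + ∑ k ∈ Finset.range N, |tail q k - tail r k| := fun N => by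
    induction N with
    | zero =>
      simp only [zero_add, Finset.sum_range_one, Finset.range_zero, Finset.sum_empty, add_zero,
        tail_zero]
      rw [abs_sub_comm]
      exact (congrArg _ (by ring)).le
    | succ N ih =>
      have h1 : q (N + 1) - r (N + 1)
          = (tail q N - tail r N) - (tail q (N + 1) - tail r (N + 1)) := by
        rw [tail_succ, tail_succ]; ring
      have h2 := abs_sub (tail q N - tail r N) (tail q (N + 1) - tail r (N + 1))
      rw [← h1] at h2
      rw [Finset.sum_range_succ _ (N + 1), Finset.sum_range_succ _ (N + 1)]
      rw [Finset.sum_range_succ (fun k => |tail q k - tail r k|) N] at ih ⊢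
      linarith
  refine Real.tsum_le_of_sum_range_le (fun n => abs_nonneg _) fun N => ?_
  have h1 := Finset.sum_le_sum_of_subset_of_nonneg (Finset.range_subset_range.2 N.le_succ)
    fun n _ _ => abs_nonneg (q n - r n)
  linarith [hind N, hpart N, hpart (N + 1)]

theorem IsSolutionFrom.ell1Dist_truncatedPoisson_le {μ : ℝ} {p0 : ℕ → ℝ} {p : ℝ → ℕ → ℝ}
    (hp : IsSolutionFrom p0 μ p) (hμ : 1 < μ) {g g' : ℝ → ℝ} (hg : ∀ s, HasDerivAt g (g' s) s)
    (hle : ∀ s, 0 ≤ s → 2 * Real.exp s * |activeAlong μ p s - nu μ| ≤ g' s) {T : ℝ}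
    (hT : 0 ≤ T) :
    ell1Dist (p T) (truncatedPoisson (nu μ)) ≤ 2 * (2 * μ + (g T - g 0)) * Real.exp (-T) := by
  have hf := hp.tailFlow
  have hs := tailFlow_truncatedPoisson hμ
  have h1 := hf.tsum_abs_sub_le hμ hg hle hT
  have h2 := ell1Dist_le_two_mul_tsum (q := p T) (r := truncatedPoisson (nu μ))
    ((hf.hasSum T hT).summable.sub (hs.hasSum 0 le_rfl).summable).abs
  refine h2.trans ?_
  rw [Real.exp_neg, ← div_eq_mul_inv, le_div_iff₀ (Real.exp_pos _)]
  linarith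

theorem one_le_japaneseBracket (t : ℝ) : 1 ≤ japaneseBracket t :=
  Real.one_le_sqrt.2 (by nlinarith [sq_nonneg t])

theorem le_japaneseBracket (t : ℝ) : t ≤ japaneseBracket t :=
  Real.le_sqrt_of_sq_le (by linarith)

theorem exists_bound_of_nu_lt_one {μ : ℝ} (hμ : 1 < μ) (hν : nu μ < 1) :
    ∃ C : ℝ, 0 < C ∧ ∀ (p0 : ℕ → ℝ) (p : ℝ → ℕ → ℝ), IsSolutionFrom p0 μ p →
      ∀ t : ℝ, 0 ≤ t → ell1Dist (p t) (truncatedPoisson (nu μ))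
        ≤ C * japaneseBracket t ^ (1 / 2 : ℝ) * Real.exp (-nu μ * t) := by
  obtain ⟨D, hD0, hD⟩ := exists_abs_active_sub_nu_le hμ
  have hν' : 0 < 1 - nu μ := by linarith
  refine ⟨4 * μ + 4 * D / (1 - nu μ), by positivity, fun p0 p hp t ht => ?_⟩
  have h1 := hp.ell1Dist_truncatedPoisson_le hμ
    (g := fun s => 2 * D / (1 - nu μ) * Real.exp ((1 - nu μ) * s))
    (g' := fun s => 2 * D * Real.exp ((1 - nu μ) * s)) (fun s => by
      have h2 : HasDerivAt (fun s => Real.exp ((1 - nu μ) * s))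
          (Real.exp ((1 - nu μ) * s) * (1 - nu μ)) s := by
        simpa using ((hasDerivAt_id s).const_mul (1 - nu μ)).exp
      refine (h2.const_mul (2 * D / (1 - nu μ))).congr_deriv ?_
      field_simp)
    (fun s hs => by
      have h2 := mul_le_mul_of_nonneg_left (hD _ _ hp.tailFlow s hs)
        (by positivity : 0 ≤ 2 * Real.exp s)
      rw [min_eq_left hν.le] at h2
      refine h2.trans_eq ?_
      rw [show (1 - nu μ) * s = s + -nu μ * s by ring, Real.exp_add]; ring) ht
  have h3 : Real.exp (-t) ≤ Real.exp (-nu μ * t) := Real.exp_le_exp.2 (by nlinarith)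
  have h4 : Real.exp ((1 - nu μ) * t) * Real.exp (-t) = Real.exp (-nu μ * t) := by
    rw [← Real.exp_add]; ring_nf
  have h5 : 0 ≤ 2 * D / (1 - nu μ) := by positivity
  have h6 : ell1Dist (p t) (truncatedPoisson (nu μ))
      ≤ (4 * μ + 4 * D / (1 - nu μ)) * Real.exp (-nu μ * t) := by
    calc _ ≤ _ := h1
      _ ≤ 4 * μ * Real.exp (-t)
          + 2 * (2 * D / (1 - nu μ)) * (Real.exp ((1 - nu μ) * t) * Real.exp (-t)) := by
        have := mul_nonneg (mul_nonneg h5 (Real.exp_pos ((1 - nu μ) * 0)).le) (Real.exp_pos (-t)).le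
        linarith
      _ ≤ 4 * μ * Real.exp (-nu μ * t) + 2 * (2 * D / (1 - nu μ)) * Real.exp (-nu μ * t) := by
        rw [h4]; gcongr
      _ = _ := by ring
  -- The bound `h6` is already free of the bracket, which is at least `1`.
  refine h6.trans (mul_le_mul_of_nonneg_right ?_ (Real.exp_pos _).le)
  exact le_mul_of_one_le_right (by positivity)
    (Real.one_le_rpow (one_le_japaneseBracket t) (by norm_num))

theorem exists_bound_of_one_le_nu {μ : ℝ} (hμ : 1 < μ) (hν : 1 ≤ nu μ) :
    ∃ C : ℝ, 0 < C ∧ ∀ (p0 : ℕ → ℝ) (p : ℝ → ℕ → ℝ), IsSolutionFrom p0 μ p →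
      ∀ t : ℝ, 0 ≤ t → ell1Dist (p t) (truncatedPoisson (nu μ))
        ≤ C * japaneseBracket t * Real.exp (-t) := by
  obtain ⟨D, hD0, hD⟩ := exists_abs_active_sub_nu_le hμ
  refine ⟨4 * μ + 4 * D, by positivity, fun p0 p hp t ht => ?_⟩
  have h1 := hp.ell1Dist_truncatedPoisson_le hμ (g := fun s => 2 * D * s)
    (g' := fun _ => 2 * D) (fun s => by simpa using (hasDerivAt_id s).const_mul (2 * D))
    (fun s hs => by
      have h2 := mul_le_mul_of_nonneg_left (hD _ _ hp.tailFlow s hs)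
        (by positivity : 0 ≤ 2 * Real.exp s)
      rw [min_eq_right hν] at h2
      refine h2.trans_eq ?_
      have h3 : Real.exp s * Real.exp (-1 * s) = 1 := by rw [← Real.exp_add]; simp
      linear_combination 2 * D * h3) ht
  refine h1.trans (mul_le_mul_of_nonneg_right ?_ (Real.exp_pos _).le)
  have h2 := mul_le_mul_of_nonneg_left (one_le_japaneseBracket t) (by linarith : 0 ≤ 4 * μ)
  have h3 := mul_le_mul_of_nonneg_left (le_japaneseBracket t) (by linarith : 0 ≤ 4 * D)
  simp only [mul_zero, sub_zero]
  linarith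

end Dispersion

theorem theorem1p1 :
    -- underpopulated and critical cases: `C` depends only on the second moment
    (∀ m₂ : ℝ, ∃ C : ℝ, 0 < C ∧
      ∀ (μ : ℝ) (p0 : ℕ → ℝ) (p : ℝ → ℕ → ℝ),
        Dispersion.IsSolutionFrom p0 μ p →
        HasSum (fun n : ℕ => (n : ℝ) ^ 2 * p0 n) m₂ →
        (0 < μ → μ < 1 → ∀ t : ℝ, 0 ≤ t →
          Dispersion.ell1Dist (p t) (Dispersion.bernoulliLaw μ)
            ≤ C * Real.exp (-2 * (1 - μ) * t)) ∧
        (μ = 1 → ∀ t : ℝ, 0 < t →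
          Dispersion.ell1Dist (p t) (Dispersion.bernoulliLaw μ) ≤ C * t⁻¹)) ∧
    -- overpopulated case: `C` and `K` depend only on the mean
    (∀ μ : ℝ, 1 < μ → μ < Real.exp 1 / (Real.exp 1 - 1) →
      ∃ C : ℝ, 0 < C ∧
        ∀ (p0 : ℕ → ℝ) (p : ℝ → ℕ → ℝ), Dispersion.IsSolutionFrom p0 μ p →
          ∀ t : ℝ, 0 ≤ t →
            Dispersion.ell1Dist (p t) (Dispersion.truncatedPoisson (Dispersion.nu μ))
              ≤ C * Dispersion.japaneseBracket t ^ (1 / 2 : ℝ)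
                * Real.exp (-Dispersion.nu μ * t)) ∧
    (∀ μ : ℝ, Real.exp 1 / (Real.exp 1 - 1) ≤ μ →
      ∃ K : ℝ, 0 < K ∧ ∃ C : ℝ, 0 < C ∧
        ∀ (p0 : ℕ → ℝ) (p : ℝ → ℕ → ℝ), Dispersion.IsSolutionFrom p0 μ p →
          ∀ t : ℝ, 0 ≤ t →
            Dispersion.ell1Dist (p t) (Dispersion.truncatedPoisson (Dispersion.nu μ))
              ≤ C * Dispersion.japaneseBracket t ^ (K + 1 / 2 : ℝ) * Real.exp (-t)) := by
  have he : 1 < Real.exp 1 / (Real.exp 1 - 1) := by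
    have : 1 < Real.exp 1 := Real.one_lt_exp_iff.2 one_pos
    rw [one_lt_div (by linarith)]
    linarith
  refine ⟨Dispersion.exists_bound_bernoulliLaw, fun μ hμ hμe =>
    Dispersion.exists_bound_of_nu_lt_one hμ (Dispersion.nu_lt_one hμ hμe), fun μ hμe => ?_⟩
  have hμ : 1 < μ := he.trans_le hμe
  obtain ⟨C, hC, h⟩ := Dispersion.exists_bound_of_one_le_nu hμ (Dispersion.one_le_nu hμ hμe)
  -- The bound obtained has the first power of the bracket, hence `K = 1 / 2`.
  refine ⟨1 / 2, by norm_num, C, hC, fun p0 p hp t ht => ?_⟩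
  rw [show (1 / 2 + 1 / 2 : ℝ) = 1 by norm_num, Real.rpow_one]
  exact h p0 p hp t ht
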